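/- Let $\mathbb I=[0,1)$ with Lebesgue measure. For $x\in\mathbb I$ let $x=\sum_{j\ge0}x_j2^{-(j+1)}$, $x_j\in\{0,1\}$, be its dyadic expansion (the one terminating in zeros if $x$ is a dyadic rational), and for $n\in\mathbb N=\{0,1,2,\dots\}$ let $n=\sum_{j\ge0}\varepsilon_j(n)2^j$, $\varepsilon_j(n)\in\{0,1\}$. The Walsh--Paley functions are $w_n(x)=(-1)^{\sum_j\varepsilon_j(n)x_j}$. For real-valued $f\in L_1(\mathbb I)$ put $\widehat f(i)=\int_{\mathbb I}f w_i$ and $S_M(f;x)=\sum_{i=0}^{M-1}\widehat f(i)w_i(x)$. For $0<p<\infty$ the dyadic Hardy space $H_p(\mathbb I)$ consists of all $f\in L_1(\mathbb I)$ with $$\|f\|_{H_p}:=\Big\|\sup_{n\in\mathbb N}|S_{2^n}(f)|\Big\|_p<\infty .$$ Let $(q_k)_{k\ge0}$ be a non-increasing sequence of positive real numbers, $Q_n=\sum_{k=0}^{n-1}q_k$ for $n\ge1$, and let $$t_n(f;x)=\frac1{Q_n}\sum_{k=1}^nq_{n-k}S_k(f;x),\qquad t^*(f;x)=\sup_{n\ge1}|t_n(f;x)|$$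 be the Nörlund means of the Walsh--Fourier series and their maximal operator. Assume that $t^*$ is bounded from $L_\infty(\mathbb I)$ to $L_\infty(\mathbb I)$, i.e. $\|t^*(f)\|_\infty\le C\|f\|_\infty$ for all $f\in L_\infty(\mathbb I)$ with some finite constant $C$, and let $p\in(1/2,1]$. Then $t^*$ is bounded from $H_p(\mathbb I)$ to $L_p(\mathbb I)$, i.e. $\|t^*(f)\|_p\le C_p\|f\|_{H_p}$ for all $f\in H_p(\mathbb I)$ with some finite constant $C_p$, if and only if $$\sup_{N\in\mathbb N}\frac{2^{N(1-p)}}{Q_{2^N}^p}\sum_{j=1}^NQ_{2^j}^p\,2^{j(p-1)}<\infty .$$ -/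

import Mathlib

open MeasureTheory
open scoped ENNReal NNReal

noncomputable section

namespace WalshNorlund

/-- Lebesgue measure on the unit interval `[0, 1)`. -/
def unitMeasure : Measure ℝ := volume.restrict (Set.Ico (0 : ℝ) 1)

/-- The dyadic digit `x_n` of `x ∈ [0, 1)`, where `x = ∑ x_n 2^{-(n+1)}`; for dyadic rationals
this is the expansion that terminates in zeros. -/
def digit (x : ℝ) (n : ℕ) : ℕ := ⌊(2 : ℝ) ^ (n + 1) * x⌋₊ % 2

/-- The binary coefficient `ε_j(n)`, where `n = ∑ ε_j(n) 2^j`. -/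
def binCoeff (n j : ℕ) : ℕ := n / 2 ^ j % 2

/-- The `n`-th Walsh-Paley function `w_n(x) = (-1)^{∑_j ε_j(n) x_j}`. The sum may stop at `j < n`,
because `ε_j(n) = 0` for `j ≥ n`. -/
def walsh (n : ℕ) (x : ℝ) : ℝ :=
  (-1) ^ (∑ j ∈ Finset.range n, binCoeff n j * digit x j)

/-- The `i`-th Walsh-Fourier coefficient of `f`. -/
def walshCoeff (f : ℝ → ℝ) (i : ℕ) : ℝ := ∫ t, f t * walsh i t ∂unitMeasure

/-- The partial sum `S_M(f; x) = ∑_{i < M} \hat f(i) w_i(x)`. -/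
def partialSum (M : ℕ) (f : ℝ → ℝ) (x : ℝ) : ℝ :=
  ∑ i ∈ Finset.range M, walshCoeff f i * walsh i x

/-- The dyadic maximal function `E^*(f; x) = sup_n |S_{2^n}(f; x)|`. -/
def dyadicMaximal (f : ℝ → ℝ) (x : ℝ) : ℝ≥0∞ := ⨆ n : ℕ, ‖partialSum (2 ^ n) f x‖ₑ

/-- The (quasi-)norm `‖f‖_{H_p} = ‖E^*(f)‖_p`. -/
def hardyNorm (p : ℝ) (f : ℝ → ℝ) : ℝ≥0∞ :=
  eLpNorm (dyadicMaximal f) (ENNReal.ofReal p) unitMeasure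

/-- Membership in the dyadic Hardy space `H_p`: integrable functions with `‖f‖_{H_p} < ∞`. -/
def MemHardy (p : ℝ) (f : ℝ → ℝ) : Prop := Integrable f unitMeasure ∧ hardyNorm p f < ∞

/-- `Q_n = ∑_{k < n} q_k`. -/
def weightSum (q : ℕ → ℝ) (n : ℕ) : ℝ := ∑ k ∈ Finset.range n, q k

/-- The Nörlund mean `t_n(f; x) = Q_n^{-1} ∑_{k=1}^n q_{n-k} S_k(f; x)`. -/
def norlundMean (q : ℕ → ℝ) (n : ℕ) (f : ℝ → ℝ) (x : ℝ) : ℝ :=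
  1 / weightSum q n * ∑ k ∈ Finset.Icc 1 n, q (n - k) * partialSum k f x

/-- The maximal operator `t^*(f; x) = sup_{n ≥ 1} |t_n(f; x)|`. -/
def norlundMaximal (q : ℕ → ℝ) (f : ℝ → ℝ) (x : ℝ) : ℝ≥0∞ :=
  ⨆ n : ℕ, ⨆ _ : 1 ≤ n, ‖norlundMean q n f x‖ₑ

/-- `t^*` is bounded from `L_∞` to `L_∞`. -/
def MaximalBoundedLInfty (q : ℕ → ℝ) : Prop :=
  ∃ C : ℝ≥0, ∀ f : ℝ → ℝ, MemLp f ∞ unitMeasure →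
    eLpNorm (norlundMaximal q f) ∞ unitMeasure ≤ C * eLpNorm f ∞ unitMeasure

/-- `t^*` is bounded from `H_p` to `L_p`. -/
def MaximalBoundedHardy (q : ℕ → ℝ) (p : ℝ) : Prop :=
  ∃ C : ℝ≥0, ∀ f : ℝ → ℝ, MemHardy p f →
    eLpNorm (norlundMaximal q f) (ENNReal.ofReal p) unitMeasure ≤ C * hardyNorm p f

end WalshNorlund

end

noncomputable section

namespace WalshNorlund

/-! ### Walsh functions and Dirichlet kernels of a sequence of signs -/

/-! Both directions are size estimates of `t^*` on dyadic cells. Walsh functions are viewed as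
functions of a sequence of signs, so the kernel at a pair `x, y` is a Dirichlet kernel evaluated at
the products of their Rademacher values.

Sufficiency for atoms. Let an atom of height `A` live on a cell of length `2^{-N}`. On that cell the
`L_∞` bound gives `t^* ≤ C A`. Off it, let `s` and `v` be the first and second digits in which `x`
differs from the cell (`v = N` if there is no second one). There `|D_l| ≤ 2^{s+1}`, and for `v < N`
the kernels cancel over blocks of length `2^{v+1}`. Abel summation then leaves only the leading
`2^v` weights (`abs_weighted_signDirichlet_le`), whence `t^* ≤ 30 A 2^{s-N} Q_{2^v} / Q_{2^N}`
(`IsAtom.abs_norlundMean_le`). Each pair `(s, v)` occupies at most one cell of measure `2^{-v}`, so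
summing `p`-th powers produces exactly the quantity in the criterion (`sum_atom_bounds_le`).

Sufficiency in general. The martingale of cell averages has a predictable majorant, rounded up to
powers of two. The increments made while the rounded majorant keeps one value form an atom
(`isAtom_atomFun`). Along a path the heights at least double, so the `p`-th powers of the heights
sum to a multiple of the last one, and dyadic regularity compares the majorant with the maximal
function (`sum_atomSize_le`). Subadditivity of `t ↦ t^p` for `p ≤ 1` adds up the pieces. All
decompositions are finite: means of order at most `2^m` see only the conditional expectation at
level `m`, and monotone convergence removes `m`.

Necessity. The test function is `D_{2^{N+1}} - D_{2^N}`. Its mean of order `2^N + 2^s` is at least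
`2^s Q_{2^s} / (8 Q_{2^N})` in absolute value on `[0, 2^{-s})`. Adding `p`-th powers over the
disjoint intervals `[2^{-s-1}, 2^{-s})` recovers the same quantity. -/

theorem binCoeff_of_lt {n j : ℕ} (h : n < 2 ^ j) : binCoeff n j = 0 := by
  simp [binCoeff, Nat.div_eq_of_lt h]

theorem binCoeff_two_pow_mul_add {N k l : ℕ} (hl : l < 2 ^ N) (j : ℕ) :
    binCoeff (2 ^ N * k + l) j = binCoeff (2 ^ N * k) j + binCoeff l j := by
  rcases lt_or_ge j N with h | h
  · obtain ⟨d, rfl⟩ : ∃ d, N = j + (d + 1) := ⟨N - j - 1, by omega⟩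
    have e : 2 ^ (j + (d + 1)) * k = 2 ^ j * (2 * (2 ^ d * k)) := by ring
    simp only [binCoeff, e, Nat.mul_add_div (Nat.two_pow_pos j),
      Nat.mul_div_cancel_left _ (Nat.two_pow_pos j)]
    omega
  · obtain ⟨d, rfl⟩ : ∃ d, j = N + d := ⟨j - N, by omega⟩
    have h0 : l / 2 ^ N = 0 := Nat.div_eq_of_lt hl
    simp only [binCoeff, pow_add, ← Nat.div_div_eq_div_mul, Nat.mul_add_div (Nat.two_pow_pos N),
      Nat.mul_div_cancel_left _ (Nat.two_pow_pos N), h0]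
    simp

/-- The Walsh function of index `n` evaluated at a sequence `r` of Rademacher values. -/
def signWalsh (n : ℕ) (r : ℕ → ℝ) : ℝ := ∏ j ∈ Finset.range n, r j ^ binCoeff n j

/-- The Walsh-Dirichlet kernel evaluated at a sequence `r` of Rademacher values. -/
def signDirichlet (k : ℕ) (r : ℕ → ℝ) : ℝ := ∑ i ∈ Finset.range k, signWalsh i r

theorem signWalsh_eq_prod {n M : ℕ} (h : n < 2 ^ M) (r : ℕ → ℝ) :
    signWalsh n r = ∏ j ∈ Finset.range M, r j ^ binCoeff n j := by
  have key : ∀ {a b : ℕ}, a ≤ b → n < 2 ^ a →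
      ∏ j ∈ Finset.range a, r j ^ binCoeff n j = ∏ j ∈ Finset.range b, r j ^ binCoeff n j := by
    intro a b hab ha
    refine Finset.prod_subset (by simpa using hab) fun j _ hj => ?_
    have : a ≤ j := by simpa using hj
    rw [binCoeff_of_lt (ha.trans_le (Nat.pow_le_pow_right two_pos this)), pow_zero]
  rcases le_total n M with h' | h'
  · exact key h' Nat.lt_two_pow_self
  · exact (key h' h).symm

theorem signWalsh_two_pow_mul_add {N k l : ℕ} (hl : l < 2 ^ N) (r : ℕ → ℝ) :
    signWalsh (2 ^ N * k + l) r = signWalsh (2 ^ N * k) r * signWalsh l r := by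
  have h1 : 2 ^ N * k + l < 2 ^ (2 ^ N * k + l) := Nat.lt_two_pow_self
  rw [signWalsh_eq_prod h1, signWalsh_eq_prod (M := 2 ^ N * k + l) (n := 2 ^ N * k) (by omega),
    signWalsh_eq_prod (M := 2 ^ N * k + l) (n := l) (by omega), ← Finset.prod_mul_distrib]
  exact Finset.prod_congr rfl fun j _ => by rw [binCoeff_two_pow_mul_add hl, pow_add]

theorem signWalsh_congr {n M : ℕ} (h : n < 2 ^ M) {r r' : ℕ → ℝ} (hr : ∀ j < M, r j = r' j) :
    signWalsh n r = signWalsh n r' := by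
  rw [signWalsh_eq_prod h, signWalsh_eq_prod h]
  exact Finset.prod_congr rfl fun j hj => by rw [hr j (Finset.mem_range.1 hj)]

/-- Replaces dyadic addition of points: a product `w_n(x) w_n(y)` is one Walsh value at the
pointwise product of the two sign sequences. -/
theorem signWalsh_mul (n : ℕ) (r r' : ℕ → ℝ) :
    signWalsh n (fun j => r j * r' j) = signWalsh n r * signWalsh n r' := by
  simp only [signWalsh, mul_pow, Finset.prod_mul_distrib]

theorem abs_signWalsh {r : ℕ → ℝ} (hr : ∀ j, |r j| = 1) (n : ℕ) : |signWalsh n r| = 1 := by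
  simp [signWalsh, Finset.abs_prod, abs_pow, hr]

theorem signWalsh_zero (r : ℕ → ℝ) : signWalsh 0 r = 1 := by simp [signWalsh]

theorem signWalsh_two_pow (N : ℕ) (r : ℕ → ℝ) : signWalsh (2 ^ N) r = r N := by
  rw [signWalsh_eq_prod (M := N + 1) (Nat.pow_lt_pow_right one_lt_two (Nat.lt_succ_self N)),
    Finset.prod_range_succ, Finset.prod_eq_one]
  · simp [binCoeff]
  · intro j hj
    obtain ⟨d, rfl⟩ : ∃ d, N = j + (d + 1) := ⟨N - j - 1, by have := Finset.mem_range.1 hj; omega⟩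
    have : binCoeff (2 ^ (j + (d + 1))) j = 0 := by
      rw [binCoeff, pow_add, Nat.mul_div_cancel_left _ (Nat.two_pow_pos j), pow_succ]
      omega
    rw [this, pow_zero]

theorem signDirichlet_zero (r : ℕ → ℝ) : signDirichlet 0 r = 0 := by simp [signDirichlet]

theorem signDirichlet_two_pow_mul_add {N k l : ℕ} (hl : l ≤ 2 ^ N) (r : ℕ → ℝ) :
    signDirichlet (2 ^ N * k + l) r =
      signDirichlet (2 ^ N * k) r + signWalsh (2 ^ N * k) r * signDirichlet l r := by
  rw [signDirichlet, Finset.sum_range_add, signDirichlet, signDirichlet, Finset.mul_sum]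
  congr 1
  exact Finset.sum_congr rfl fun i hi =>
    signWalsh_two_pow_mul_add ((Finset.mem_range.1 hi).trans_le hl) r

theorem signDirichlet_two_pow_add {N l : ℕ} (hl : l ≤ 2 ^ N) (r : ℕ → ℝ) :
    signDirichlet (2 ^ N + l) r = signDirichlet (2 ^ N) r + r N * signDirichlet l r := by
  simpa [signWalsh_two_pow] using signDirichlet_two_pow_mul_add (k := 1) hl r

theorem signDirichlet_two_pow (N : ℕ) (r : ℕ → ℝ) :
    signDirichlet (2 ^ N) r = ∏ j ∈ Finset.range N, (1 + r j) := by
  induction N with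
  | zero => simp [signDirichlet, signWalsh_zero]
  | succ N ih =>
    rw [pow_succ, mul_two, signDirichlet_two_pow_add le_rfl, Finset.prod_range_succ, ih]
    ring

/-- The factor `1 + r s` kills the product formula for `D_{2^N}`, and every later block of length
`2^N` is a multiple of `D_{2^N}`. -/
theorem signDirichlet_two_pow_mul_eq_zero {N s : ℕ} {r : ℕ → ℝ} (hs : s < N) (hr : r s = -1)
    (k : ℕ) : signDirichlet (2 ^ N * k) r = 0 := by
  have h0 : signDirichlet (2 ^ N) r = 0 := by
    rw [signDirichlet_two_pow]
    exact Finset.prod_eq_zero (Finset.mem_range.2 hs) (by rw [hr]; norm_num)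
  induction k with
  | zero => simp [signDirichlet_zero]
  | succ k ih => rw [mul_add_one, signDirichlet_two_pow_mul_add le_rfl, ih, h0]; simp

theorem signDirichlet_of_ones {N l : ℕ} {r : ℕ → ℝ} (hr : ∀ j < N, r j = 1) (hl : l ≤ 2 ^ N) :
    signDirichlet l r = l := by
  rw [signDirichlet, Finset.sum_congr rfl (g := fun _ => (1 : ℝ))]
  · simp
  · intro i hi
    rw [signWalsh_congr ((Finset.mem_range.1 hi).trans_le hl) (r' := fun _ => 1) hr]
    simp [signWalsh]

theorem abs_signDirichlet_le_index {r : ℕ → ℝ} (hr : ∀ j, |r j| = 1) (k : ℕ) :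
    |signDirichlet k r| ≤ k := by
  refine (Finset.abs_sum_le_sum_abs _ _).trans ?_
  simp [abs_signWalsh hr]

theorem signDirichlet_eq_mod {N s : ℕ} {r : ℕ → ℝ} (hs : s < N) (hr : r s = -1) (k : ℕ) :
    signDirichlet k r = signWalsh (2 ^ N * (k / 2 ^ N)) r * signDirichlet (k % 2 ^ N) r := by
  conv_lhs => rw [← Nat.div_add_mod k (2 ^ N)]
  rw [signDirichlet_two_pow_mul_add (Nat.mod_lt _ (Nat.two_pow_pos N)).le,
    signDirichlet_two_pow_mul_eq_zero hs hr, zero_add]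

/-- All complete blocks of length `2^(s+1)` cancel, so only the remainder modulo `2^(s+1)`
contributes. -/
theorem abs_signDirichlet_le {s : ℕ} {r : ℕ → ℝ} (hr : ∀ j, |r j| = 1) (hs : r s = -1) (k : ℕ) :
    |signDirichlet k r| ≤ 2 ^ (s + 1) := by
  rw [signDirichlet_eq_mod (Nat.lt_succ_self s) hs, abs_mul, abs_signWalsh hr, one_mul]
  refine (abs_signDirichlet_le_index hr _).trans ?_
  exact_mod_cast (Nat.mod_lt _ (Nat.two_pow_pos _)).le

theorem sum_range_mul_eq (M K : ℕ) (a : ℕ → ℝ) :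
    ∑ k ∈ Finset.range (M * K), a k =
      ∑ k ∈ Finset.range K, ∑ l ∈ Finset.range M, a (M * k + l) := by
  induction K with
  | zero => simp
  | succ K ih => rw [mul_add_one, Finset.sum_range_add, ih, Finset.sum_range_succ]

/-- The Fejér type sums of Dirichlet kernels, when two Rademacher values equal `-1`. -/
theorem abs_sum_signDirichlet_le {s v : ℕ} {r : ℕ → ℝ} (hr : ∀ j, |r j| = 1) (hsv : s < v)
    (hs : r s = -1) (hv : r v = -1) (n : ℕ) :
    |∑ j ∈ Finset.range n, signDirichlet j r| ≤ 2 ^ (v + 1) * 2 ^ (s + 1) := by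
  -- The sign at `s` gives `D_{2^v} = 0`, and the sign at `v` then gives `D_{2^v + i} = -D_i`: the
  -- two halves of the block cancel.
  have hblock : ∑ j ∈ Finset.range (2 ^ (v + 1)), signDirichlet j r = 0 := by
    rw [pow_succ, mul_two, Finset.sum_range_add, ← Finset.sum_add_distrib]
    refine Finset.sum_eq_zero fun i hi => ?_
    have := signDirichlet_two_pow_mul_eq_zero hsv hs 1
    rw [mul_one] at this
    rw [signDirichlet_two_pow_add (Finset.mem_range.1 hi).le, this, hv]
    ring
  have hfac : ∀ k, ∀ l ≤ 2 ^ (v + 1), signDirichlet (2 ^ (v + 1) * k + l) r =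
      signWalsh (2 ^ (v + 1) * k) r * signDirichlet l r := by
    intro k l hl
    rw [signDirichlet_two_pow_mul_add hl,
      signDirichlet_two_pow_mul_eq_zero (Nat.lt_succ_of_lt hsv) hs, zero_add]
  rw [← Nat.div_add_mod n (2 ^ (v + 1)), Finset.sum_range_add, sum_range_mul_eq,
    Finset.sum_eq_zero, zero_add]
  · have hlt := Nat.mod_lt n (Nat.two_pow_pos (v + 1))
    refine (Finset.abs_sum_le_sum_abs _ _).trans
      ((Finset.sum_le_card_nsmul _ _ (2 ^ (s + 1)) fun l _ => abs_signDirichlet_le hr hs _).trans ?_)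
    rw [Finset.card_range, nsmul_eq_mul]
    gcongr
    exact_mod_cast hlt.le
  · intro k _
    rw [Finset.sum_congr rfl fun l hl => hfac k l (Finset.mem_range.1 hl).le, ← Finset.mul_sum,
      hblock, mul_zero]

/-- Abel summation; the differences of `g` telescope back to `g 0`. -/
theorem abs_sum_mul_le_of_antitone {g e : ℕ → ℝ} (hg : Antitone g) (hg0 : ∀ i, 0 ≤ g i) {B : ℝ}
    (hB : ∀ n, |∑ i ∈ Finset.range n, e i| ≤ B) (n : ℕ) :
    |∑ i ∈ Finset.range n, g i * e i| ≤ g 0 * B := by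
  have key : ∑ i ∈ Finset.range n, g i * e i = g n * (∑ i ∈ Finset.range n, e i) +
      ∑ i ∈ Finset.range n, (g i - g (i + 1)) * ∑ k ∈ Finset.range (i + 1), e k := by
    induction n with
    | zero => simp
    | succ n ih => rw [Finset.sum_range_succ, ih, Finset.sum_range_succ (fun i => (g i - _) * _),
        Finset.sum_range_succ e]; ring
  calc |∑ i ∈ Finset.range n, g i * e i|
      ≤ g n * B + ∑ i ∈ Finset.range n, (g i - g (i + 1)) * B := by
        rw [key]
        refine (abs_add_le _ _).trans (add_le_add ?_ ((Finset.abs_sum_le_sum_abs _ _).trans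
          (Finset.sum_le_sum fun i _ => ?_)))
        · rw [abs_mul, abs_of_nonneg (hg0 n)]
          exact mul_le_mul_of_nonneg_left (hB n) (hg0 n)
        · have : 0 ≤ g i - g (i + 1) := sub_nonneg.2 (hg (Nat.le_succ i))
          rw [abs_mul, abs_of_nonneg this]
          exact mul_le_mul_of_nonneg_left (hB _) this
    _ = g 0 * B := by rw [← Finset.sum_mul, Finset.sum_range_sub']; ring

/-- A downward sum is a difference of two initial sums, hence the factor 2. Truncated subtraction
past `a` is harmless because `D_0 = 0`. -/
theorem abs_sum_reverse_signDirichlet_le {s v : ℕ} {r : ℕ → ℝ} (hr : ∀ j, |r j| = 1) (hsv : s < v)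
    (hs : r s = -1) (hv : r v = -1) (a n : ℕ) :
    |∑ i ∈ Finset.range n, signDirichlet (a - i) r| ≤ 2 * (2 ^ (v + 1) * 2 ^ (s + 1)) := by
  have key : ∑ i ∈ Finset.range n, signDirichlet (a - i) r =
      ∑ j ∈ Finset.range (a + 1), signDirichlet j r -
        ∑ j ∈ Finset.range (a + 1 - n), signDirichlet j r := by
    induction n with
    | zero => simp
    | succ n ih =>
      rw [Finset.sum_range_succ, ih]
      rcases le_or_gt n a with h | h
      · rw [show a + 1 - n = (a - n) + 1 by omega, Finset.sum_range_succ _ (a - n),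
          show a + 1 - (n + 1) = a - n by omega]
        ring
      · rw [show a + 1 - n = 0 by omega, show a + 1 - (n + 1) = 0 by omega,
          show a - n = 0 by omega]
        simp [signDirichlet_zero]
  rw [key, two_mul]
  exact (abs_sub _ _).trans (add_le_add (abs_sum_signDirichlet_le hr hsv hs hv _)
    (abs_sum_signDirichlet_le hr hsv hs hv _))

/-- Sums of Dirichlet kernels against monotone weights, over at most `2 ^ N` indices. -/
theorem abs_weighted_signDirichlet_le {q : ℕ → ℝ} (hpos : ∀ k, 0 < q k) (hanti : Antitone q)
    {N s v : ℕ} {r : ℕ → ℝ} (hr : ∀ j, |r j| = 1) (hsv : s < v) (hvN : v ≤ N) (hs : r s = -1)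
    (hv : v < N → r v = -1) {L : ℕ} (hL : L < 2 ^ N) (c : ℕ) :
    |∑ l ∈ Finset.range (L + 1), q (c + L - l) * signDirichlet l r| ≤
      10 * 2 ^ s * ∑ i ∈ Finset.range (2 ^ v), q (c + i) := by
  have hrev : ∑ l ∈ Finset.range (L + 1), q (c + L - l) * signDirichlet l r =
      ∑ i ∈ Finset.range (L + 1), q (c + i) * signDirichlet (L - i) r := by
    rw [← Finset.sum_range_reflect]
    refine Finset.sum_congr rfl fun i hi => ?_
    have := Finset.mem_range.1 hi
    rw [show c + L - (L + 1 - 1 - i) = c + i by omega, show L + 1 - 1 - i = L - i by omega]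
  have hext : ∀ M, L + 1 ≤ M → ∑ i ∈ Finset.range (L + 1), q (c + i) * signDirichlet (L - i) r =
      ∑ i ∈ Finset.range M, q (c + i) * signDirichlet (L - i) r := by
    intro M hM
    refine Finset.sum_subset (by simpa using hM) fun i _ hi => ?_
    have : L + 1 ≤ i := by simpa using hi
    rw [show L - i = 0 by omega, signDirichlet_zero, mul_zero]
  have hfirst : |∑ i ∈ Finset.range (2 ^ v), q (c + i) * signDirichlet (L - i) r| ≤
      2 * 2 ^ s * ∑ i ∈ Finset.range (2 ^ v), q (c + i) := by
    refine (Finset.abs_sum_le_sum_abs _ _).trans ?_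
    rw [Finset.mul_sum]
    refine Finset.sum_le_sum fun i _ => ?_
    rw [abs_mul, abs_of_pos (hpos _), mul_comm, mul_comm 2, ← pow_succ]
    exact mul_le_mul_of_nonneg_right (abs_signDirichlet_le hr hs _) (hpos _).le
  have hS : 2 ^ v * q (c + 2 ^ v) ≤ ∑ i ∈ Finset.range (2 ^ v), q (c + i) := by
    have := Finset.card_nsmul_le_sum (Finset.range (2 ^ v)) (fun i => q (c + i)) (q (c + 2 ^ v))
      fun i hi => hanti (by have := Finset.mem_range.1 hi; omega)
    simpa using this
  have hS0 : 0 ≤ ∑ i ∈ Finset.range (2 ^ v), q (c + i) := Finset.sum_nonneg fun i _ => (hpos _).le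
  have h2s : (0 : ℝ) < 2 ^ s := by positivity
  rw [hrev]
  -- For `v = N` the first `2^v` weights already cover all terms, as `L < 2^N`; otherwise the tail
  -- uses cancellation at the second sign.
  rcases hvN.eq_or_lt with rfl | hlt
  · rw [hext _ hL]
    refine hfirst.trans ?_
    gcongr
    norm_num
  · rw [hext (2 ^ v + (L + 1)) (Nat.le_add_left _ _), Finset.sum_range_add]
    have hsecond := abs_sum_mul_le_of_antitone (g := fun i => q (c + (2 ^ v + i)))
      (e := fun i => signDirichlet (L - 2 ^ v - i) r) (fun i j hij => hanti (by omega))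
      (fun i => (hpos _).le)
      (fun n => abs_sum_reverse_signDirichlet_le hr hsv hs (hv hlt) (L - 2 ^ v) n) (L + 1)
    simp only [Nat.sub_sub, add_zero] at hsecond
    refine (abs_add_le _ _).trans ((add_le_add hfirst hsecond).trans ?_)
    -- The head contributes 2. The tail is at most `8 * 2^s * 2^v * q (c + 2^v)`, and by
    -- monotonicity `hS` this contributes 8.
    rw [pow_succ, pow_succ]
    nlinarith [mul_le_mul_of_nonneg_left hS h2s.le]

/-! ### Dyadic cells -/

/-- The index of the dyadic interval of length `2 ^ (-n)` that contains `x`. -/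
def cell (n : ℕ) (x : ℝ) : ℕ := ⌊(2 : ℝ) ^ n * x⌋₊

/-- The value at `x` of the `j`-th Rademacher function. -/
def rad (x : ℝ) (j : ℕ) : ℝ := (-1) ^ digit x j

theorem digit_eq_cell (x : ℝ) (n : ℕ) : digit x n = cell (n + 1) x % 2 := rfl

theorem cell_succ_div_two (n : ℕ) (x : ℝ) : cell (n + 1) x / 2 = cell n x := by
  rw [cell, cell, ← Nat.floor_div_ofNat]
  congr 1
  rw [pow_succ]
  ring

theorem cell_succ (n : ℕ) (x : ℝ) : cell (n + 1) x = 2 * cell n x + digit x n := by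
  have := cell_succ_div_two n x
  rw [digit_eq_cell]
  omega

theorem cell_eq_of_le {m n : ℕ} (h : m ≤ n) {x y : ℝ} (hxy : cell n x = cell n y) :
    cell m x = cell m y := by
  induction n, h using Nat.le_induction with
  | base => exact hxy
  | succ n _ ih => exact ih (by rw [← cell_succ_div_two, hxy, cell_succ_div_two])

theorem digit_eq_of_cell_eq {n : ℕ} {x y : ℝ} (hxy : cell n x = cell n y) {j : ℕ} (hj : j < n) :
    digit x j = digit y j := by
  rw [digit_eq_cell, digit_eq_cell, cell_eq_of_le (Nat.succ_le_of_lt hj) hxy]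

theorem digit_lt_two (x : ℝ) (j : ℕ) : digit x j < 2 := Nat.mod_lt _ two_pos

theorem cell_zero {x : ℝ} (hx : x ∈ Set.Ico (0 : ℝ) 1) : cell 0 x = 0 := by
  simp [cell, hx.2]

theorem cell_lt {x : ℝ} (hx : x ∈ Set.Ico (0 : ℝ) 1) (n : ℕ) : cell n x < 2 ^ n := by
  rw [cell, Nat.floor_lt (mul_nonneg (by positivity) hx.1)]
  push_cast
  nlinarith [hx.2, pow_pos (two_pos : (0 : ℝ) < 2) n]

theorem cell_eq_of_digit_eq {x y : ℝ} (hx : x ∈ Set.Ico (0 : ℝ) 1) (hy : y ∈ Set.Ico (0 : ℝ) 1)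
    {n : ℕ} (h : ∀ j < n, digit x j = digit y j) : cell n x = cell n y := by
  induction n with
  | zero => rw [cell_zero hx, cell_zero hy]
  | succ n ih =>
    rw [cell_succ, cell_succ, ih fun j hj => h j (Nat.lt_succ_of_lt hj), h n (Nat.lt_succ_self n)]

theorem cell_eq_iff {x : ℝ} (hx : 0 ≤ x) (n c : ℕ) :
    cell n x = c ↔ x ∈ Set.Ico ((c : ℝ) / 2 ^ n) ((c + 1) / 2 ^ n) := by
  have h2 : (0 : ℝ) < 2 ^ n := by positivity
  rw [cell, Nat.floor_eq_iff (by positivity), Set.mem_Ico, div_le_iff₀ h2, lt_div_iff₀ h2,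
    mul_comm x]

/-- The left end point of a dyadic interval. -/
def cellPoint (n c : ℕ) : ℝ := (c : ℝ) / 2 ^ n

theorem cell_cellPoint (n c : ℕ) : cell n (cellPoint n c) = c := by
  simp [cell, cellPoint, mul_div_cancel₀]

theorem cellPoint_mem {n c : ℕ} (h : c < 2 ^ n) : cellPoint n c ∈ Set.Ico (0 : ℝ) 1 := by
  refine ⟨by unfold cellPoint; positivity, ?_⟩
  rw [cellPoint, div_lt_one (by positivity)]
  exact_mod_cast h

theorem measurable_cell (n : ℕ) : Measurable (cell n) :=
  Nat.measurable_floor.comp (measurable_const_mul _)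

theorem measurable_comp_cell {α : Type*} [MeasurableSpace α] (n : ℕ) (G : ℕ → α) :
    Measurable fun x => G (cell n x) :=
  (measurable_from_nat (f := G)).comp (measurable_cell n)

theorem measurable_rad (j : ℕ) : Measurable fun x => rad x j :=
  measurable_comp_cell (j + 1) fun c => (-1 : ℝ) ^ (c % 2)

theorem abs_rad (x : ℝ) (j : ℕ) : |rad x j| = 1 := by simp [rad, abs_pow]

theorem walsh_eq (n : ℕ) (x : ℝ) : walsh n x = signWalsh n (rad x) := by
  simp only [walsh, signWalsh, rad, ← pow_mul, Finset.prod_pow_eq_pow_sum, mul_comm]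

theorem abs_walsh (n : ℕ) (x : ℝ) : |walsh n x| = 1 := by
  rw [walsh_eq, abs_signWalsh (abs_rad x)]

theorem measurable_walsh (n : ℕ) : Measurable (walsh n) := by
  have : walsh n = fun x => ∏ j ∈ Finset.range n, rad x j ^ binCoeff n j := funext (walsh_eq n)
  rw [this]
  exact Finset.measurable_prod _ fun j _ => (measurable_rad j).pow_const _

theorem walsh_congr {n i : ℕ} (hi : i < 2 ^ n) {x y : ℝ} (h : cell n x = cell n y) :
    walsh i x = walsh i y := by
  rw [walsh_eq, walsh_eq]
  exact signWalsh_congr hi fun j hj => by rw [rad, rad, digit_eq_of_cell_eq h hj]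

theorem rad_mul_rad_eq_one {x y : ℝ} {j : ℕ} (h : digit x j = digit y j) :
    rad x j * rad y j = 1 := by
  rw [rad, rad, h, ← mul_pow]; simp

theorem rad_mul_rad_eq_neg_one {x y : ℝ} {j : ℕ} (h : digit x j ≠ digit y j) :
    rad x j * rad y j = -1 := by
  have h1 := digit_lt_two x j
  have h2 := digit_lt_two y j
  have : digit x j = 0 ∧ digit y j = 1 ∨ digit x j = 1 ∧ digit y j = 0 := by omega
  rcases this with ⟨a, b⟩ | ⟨a, b⟩ <;> simp [rad, a, b]

theorem abs_rad_mul_rad (x y : ℝ) (j : ℕ) : |rad x j * rad y j| = 1 := by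
  rw [abs_mul, abs_rad, abs_rad, one_mul]

/-- The kernel of `S_{2^n}` on the unit interval. -/
theorem sum_walsh_mul_walsh {x y : ℝ} (hx : x ∈ Set.Ico (0 : ℝ) 1) (hy : y ∈ Set.Ico (0 : ℝ) 1)
    (n : ℕ) : ∑ i ∈ Finset.range (2 ^ n), walsh i x * walsh i y =
      if cell n x = cell n y then 2 ^ n else 0 := by
  have : ∑ i ∈ Finset.range (2 ^ n), walsh i x * walsh i y =
      signDirichlet (2 ^ n) fun j => rad x j * rad y j :=
    Finset.sum_congr rfl fun i _ => by rw [signWalsh_mul, walsh_eq, walsh_eq]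
  rw [this]
  split_ifs with h
  · rw [signDirichlet_of_ones (N := n) (fun j hj => rad_mul_rad_eq_one (digit_eq_of_cell_eq h hj))
      le_rfl]
    simp
  · have : ∃ j < n, digit x j ≠ digit y j := by
      by_contra! hc
      exact h (cell_eq_of_digit_eq hx hy hc)
    obtain ⟨j, hj, hne⟩ := this
    simpa using signDirichlet_two_pow_mul_eq_zero hj (rad_mul_rad_eq_neg_one hne) 1

/-! ### Integration over cells -/

instance : IsProbabilityMeasure unitMeasure := ⟨by simp [unitMeasure]⟩

theorem ae_mem_unit : ∀ᵐ x ∂unitMeasure, x ∈ Set.Ico (0 : ℝ) 1 :=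
  ae_restrict_mem measurableSet_Ico

/-- The set of all `x` whose cell of level `n` has index `c`. -/
def cellSet (n c : ℕ) : Set ℝ := {x | cell n x = c}

theorem mem_cellSet {n c : ℕ} {x : ℝ} : x ∈ cellSet n c ↔ cell n x = c := Iff.rfl

theorem indicator_cellSet {α : Type*} [Zero α] (n c : ℕ) (f : ℝ → α) (x : ℝ) :
    (cellSet n c).indicator f x = if cell n x = c then f x else 0 := by
  simp [Set.indicator, mem_cellSet]

theorem measurableSet_cellSet (n c : ℕ) : MeasurableSet (cellSet n c) :=
  measurable_cell n (measurableSet_singleton c)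

theorem unitMeasure_cellSet {n c : ℕ} (hc : c < 2 ^ n) :
    unitMeasure (cellSet n c) = ENNReal.ofReal (2 ^ n)⁻¹ := by
  have h2 : (0 : ℝ) < 2 ^ n := by positivity
  have hset : cellSet n c ∩ Set.Ico 0 1 = Set.Ico ((c : ℝ) / 2 ^ n) ((c + 1) / 2 ^ n) := by
    ext x
    constructor
    · rintro ⟨h, hx⟩
      exact (cell_eq_iff hx.1 n c).1 h
    · intro h
      have h0 : 0 ≤ x := le_trans (by positivity) h.1
      have h1 : x < 1 := h.2.trans_le (by
        rw [div_le_one h2]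
        exact_mod_cast hc)
      exact ⟨(cell_eq_iff h0 n c).2 h, h0, h1⟩
  rw [unitMeasure, Measure.restrict_apply (measurableSet_cellSet n c), hset, Real.volume_Ico]
  congr 1
  field_simp
  ring

theorem unitMeasure_real_cellSet {n c : ℕ} (hc : c < 2 ^ n) :
    unitMeasure.real (cellSet n c) = (2 ^ n)⁻¹ := by
  rw [measureReal_def, unitMeasure_cellSet hc, ENNReal.toReal_ofReal (by positivity)]

theorem lintegral_comp_cell (n : ℕ) (G : ℕ → ℝ≥0∞) :
    ∫⁻ x, G (cell n x) ∂unitMeasure =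
      ∑ c ∈ Finset.range (2 ^ n), G c * ENNReal.ofReal (2 ^ n)⁻¹ := by
  have : ∫⁻ x, G (cell n x) ∂unitMeasure = ∫⁻ x, ∑ c ∈ Finset.range (2 ^ n),
      (cellSet n c).indicator (fun _ => G c) x ∂unitMeasure := by
    refine lintegral_congr_ae (ae_mem_unit.mono fun x hx => ?_)
    simp only [indicator_cellSet]
    rw [Finset.sum_ite_eq, if_pos (Finset.mem_range.2 (cell_lt hx n))]
  rw [this, lintegral_finsetSum _ fun c _ =>
    measurable_const.indicator (measurableSet_cellSet n c)]
  refine Finset.sum_congr rfl fun c hc => ?_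
  rw [lintegral_indicator_const (measurableSet_cellSet n c),
    unitMeasure_cellSet (Finset.mem_range.1 hc)]

theorem integral_mul_comp_cell {f : ℝ → ℝ} (hf : Integrable f unitMeasure) (n : ℕ) (G : ℕ → ℝ) :
    ∫ x, f x * G (cell n x) ∂unitMeasure =
      ∑ c ∈ Finset.range (2 ^ n), G c * ∫ x in cellSet n c, f x ∂unitMeasure := by
  have : ∫ x, f x * G (cell n x) ∂unitMeasure = ∫ x, ∑ c ∈ Finset.range (2 ^ n),
      G c * (cellSet n c).indicator f x ∂unitMeasure := by
    refine integral_congr_ae (ae_mem_unit.mono fun x hx => ?_)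
    simp only [indicator_cellSet, mul_ite, mul_zero]
    rw [Finset.sum_ite_eq, if_pos (Finset.mem_range.2 (cell_lt hx n)), mul_comm]
  rw [this, integral_finsetSum _ fun c _ =>
    (hf.indicator (measurableSet_cellSet n c)).const_mul _]
  refine Finset.sum_congr rfl fun c _ => ?_
  rw [integral_const_mul, integral_indicator (measurableSet_cellSet n c)]

theorem integral_comp_cell (n : ℕ) (G : ℕ → ℝ) :
    ∫ x, G (cell n x) ∂unitMeasure = (2 ^ n)⁻¹ * ∑ c ∈ Finset.range (2 ^ n), G c := by
  have := integral_mul_comp_cell (integrable_const (1 : ℝ)) n G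
  simp only [one_mul] at this
  rw [this, Finset.mul_sum]
  refine Finset.sum_congr rfl fun c hc => ?_
  rw [setIntegral_const, unitMeasure_real_cellSet (Finset.mem_range.1 hc)]
  simp [mul_comm]

theorem sum_range_two_pow_succ (n : ℕ) (G : ℕ → ℝ) :
    ∑ c ∈ Finset.range (2 ^ (n + 1)), G c =
      ∑ c ∈ Finset.range (2 ^ n), (G (2 * c) + G (2 * c + 1)) := by
  rw [pow_succ', sum_range_mul_eq]
  exact Finset.sum_congr rfl fun c _ => by simp [Finset.sum_range_succ]

/-! ### Averages over cells -/

/-- The average of `f` over a dyadic interval. -/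
def cellAvg (f : ℝ → ℝ) (n c : ℕ) : ℝ := 2 ^ n * ∫ x in cellSet n c, f x ∂unitMeasure

theorem integrable_mul_walsh {f : ℝ → ℝ} (hf : Integrable f unitMeasure) (i : ℕ) :
    Integrable (fun t => f t * walsh i t) unitMeasure :=
  hf.mul_bdd (c := 1) (measurable_walsh i).aestronglyMeasurable
    (.of_forall fun x => (abs_walsh i x).le)

/-- The kernel of `S_{2^n}` is `2^n` on the cell of `x` and zero elsewhere; thus the Hardy norm is
that of a martingale maximal function. -/
theorem partialSum_two_pow {f : ℝ → ℝ} (hf : Integrable f unitMeasure) (n : ℕ) {x : ℝ}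
    (hx : x ∈ Set.Ico (0 : ℝ) 1) : partialSum (2 ^ n) f x = cellAvg f n (cell n x) := by
  have h1 : partialSum (2 ^ n) f x =
      ∫ t, ∑ i ∈ Finset.range (2 ^ n), f t * walsh i t * walsh i x ∂unitMeasure := by
    rw [integral_finsetSum _ fun i _ => (integrable_mul_walsh hf i).mul_const _]
    exact Finset.sum_congr rfl fun i _ => by rw [integral_mul_const, walshCoeff]
  rw [h1, cellAvg, ← integral_indicator (measurableSet_cellSet _ _), ← integral_const_mul]
  refine integral_congr_ae (ae_mem_unit.mono fun t ht => ?_)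
  simp only [mul_assoc]
  rw [← Finset.mul_sum, sum_walsh_mul_walsh ht hx]
  simp only [indicator_cellSet]
  split_ifs <;> ring

theorem cellAvg_eq {f : ℝ → ℝ} (hf : Integrable f unitMeasure) (n c : ℕ) :
    cellAvg f n c = (cellAvg f (n + 1) (2 * c) + cellAvg f (n + 1) (2 * c + 1)) / 2 := by
  have hset : cellSet n c = cellSet (n + 1) (2 * c) ∪ cellSet (n + 1) (2 * c + 1) := by
    ext x
    have := cell_succ n x
    have := digit_lt_two x n
    simp only [mem_cellSet, Set.mem_union]
    omega
  have hdisj : Disjoint (cellSet (n + 1) (2 * c)) (cellSet (n + 1) (2 * c + 1)) := by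
    rw [Set.disjoint_left]
    intro x h1 h2
    simp only [mem_cellSet] at h1 h2
    omega
  rw [cellAvg, hset, setIntegral_union hdisj (measurableSet_cellSet _ _) hf.integrableOn
    hf.integrableOn, cellAvg, cellAvg, pow_succ]
  ring

theorem walsh_cellPoint {m i : ℕ} (hi : i < 2 ^ m) (x : ℝ) :
    walsh i x = walsh i (cellPoint m (cell m x)) :=
  walsh_congr hi (cell_cellPoint m _).symm

/-- `f` and its conditional expectation at level `m` have the same coefficients below `2 ^ m`. -/
theorem walshCoeff_cellAvg {f : ℝ → ℝ} (hf : Integrable f unitMeasure) {m i : ℕ}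
    (hi : i < 2 ^ m) :
    walshCoeff (fun x => cellAvg f m (cell m x)) i = walshCoeff f i := by
  have h1 : walshCoeff f i = ∫ x, f x * (fun c => walsh i (cellPoint m c)) (cell m x)
      ∂unitMeasure := by
    simp only [walshCoeff, ← walsh_cellPoint hi]
  have h2 : walshCoeff (fun x => cellAvg f m (cell m x)) i =
      ∫ x, (fun c => cellAvg f m c * walsh i (cellPoint m c)) (cell m x) ∂unitMeasure := by
    simp only [walshCoeff, ← walsh_cellPoint hi]
  rw [h1, h2, integral_comp_cell m fun c => cellAvg f m c * walsh i (cellPoint m c),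
    integral_mul_comp_cell hf m fun c => walsh i (cellPoint m c), Finset.mul_sum]
  refine Finset.sum_congr rfl fun c _ => ?_
  rw [cellAvg]
  field_simp

theorem integrable_comp_cell (n : ℕ) (G : ℕ → ℝ) :
    Integrable (fun x => G (cell n x)) unitMeasure := by
  refine Integrable.of_bound (measurable_comp_cell n G).aestronglyMeasurable
    (∑ c ∈ Finset.range (2 ^ n), |G c|) (ae_mem_unit.mono fun x hx => ?_)
  exact Finset.single_le_sum (f := fun c => |G c|) (fun c _ => abs_nonneg _)
    (Finset.mem_range.2 (cell_lt hx n))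

/-- Orthogonality of martingale increments to functions of the coarser cell: on each parent the two
child increments cancel. This gives atoms mean zero. -/
theorem integral_cellAvg_sub_mul {f : ℝ → ℝ} (hf : Integrable f unitMeasure) (n : ℕ)
    (G : ℕ → ℝ) :
    ∫ x, G (cell n x) * (cellAvg f (n + 1) (cell (n + 1) x) - cellAvg f n (cell n x))
      ∂unitMeasure = 0 := by
  have : ∀ x, G (cell n x) * (cellAvg f (n + 1) (cell (n + 1) x) - cellAvg f n (cell n x)) =
      (fun c => G (c / 2) * (cellAvg f (n + 1) c - cellAvg f n (c / 2))) (cell (n + 1) x) := by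
    intro x
    simp only [cell_succ_div_two]
  simp only [this]
  rw [integral_comp_cell (n + 1) fun c => G (c / 2) * (cellAvg f (n + 1) c - cellAvg f n (c / 2)),
    sum_range_two_pow_succ, Finset.sum_eq_zero, mul_zero]
  intro c _
  rw [show 2 * c / 2 = c by omega, show (2 * c + 1) / 2 = c by omega, cellAvg_eq hf n c]
  ring

/-! ### Weight sums -/

theorem weightSum_mono {q : ℕ → ℝ} (hpos : ∀ k, 0 < q k) : Monotone (weightSum q) := by
  intro a b hab
  exact Finset.sum_le_sum_of_subset_of_nonneg (by simpa using hab) fun i _ _ => (hpos i).le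

theorem weightSum_pos {q : ℕ → ℝ} (hpos : ∀ k, 0 < q k) {n : ℕ} (hn : 1 ≤ n) :
    0 < weightSum q n :=
  Finset.sum_pos (fun i _ => hpos i) (by simpa using Nat.one_le_iff_ne_zero.1 hn)

theorem weightSum_nonneg {q : ℕ → ℝ} (hpos : ∀ k, 0 < q k) (n : ℕ) : 0 ≤ weightSum q n :=
  Finset.sum_nonneg fun i _ => (hpos i).le

theorem weightSum_mul_le {q : ℕ → ℝ} (hanti : Antitone q) (M K : ℕ) :
    weightSum q (M * K) ≤ K * weightSum q M := by
  rw [weightSum, sum_range_mul_eq]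
  have := Finset.sum_le_card_nsmul (Finset.range K)
    (fun k => ∑ l ∈ Finset.range M, q (M * k + l)) (weightSum q M) fun k _ =>
      Finset.sum_le_sum fun l _ => hanti (by omega)
  simpa using this

/-- The averages `Q_n / n` of a non-increasing sequence do not increase along powers of two. -/
theorem weightSum_two_pow_le {q : ℕ → ℝ} (hanti : Antitone q) {v N : ℕ} (h : v ≤ N) :
    2 ^ v * weightSum q (2 ^ N) ≤ 2 ^ N * weightSum q (2 ^ v) := by
  have := weightSum_mul_le hanti (2 ^ v) (2 ^ (N - v))
  rw [← pow_add, Nat.add_sub_of_le h] at this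
  push_cast at this
  calc (2 : ℝ) ^ v * weightSum q (2 ^ N) ≤ 2 ^ v * (2 ^ (N - v) * weightSum q (2 ^ v)) := by gcongr
    _ = 2 ^ N * weightSum q (2 ^ v) := by
      rw [← mul_assoc, ← pow_add, Nat.add_sub_of_le h]

/-- For a block after the first, each of its leading `2^v` weights is at most every weight of the
preceding block, so their sum is at most the fraction `2^v / 2^N` of that block. -/
theorem sum_block_weights_le {q : ℕ → ℝ} (hanti : Antitone q) (N v K : ℕ) :
    ∑ j ∈ Finset.range (K + 1), ∑ i ∈ Finset.range (2 ^ v), q (2 ^ N * j + i) ≤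
      weightSum q (2 ^ v) + 2 ^ v / 2 ^ N * weightSum q (2 ^ N * K) := by
  induction K with
  | zero => simp [weightSum]
  | succ K ih =>
    rw [Finset.sum_range_succ]
    have h1 : ∑ i ∈ Finset.range (2 ^ v), q (2 ^ N * (K + 1) + i) ≤
        2 ^ v * q (2 ^ N * (K + 1)) := by
      have := Finset.sum_le_card_nsmul (Finset.range (2 ^ v)) (fun i => q (2 ^ N * (K + 1) + i))
        (q (2 ^ N * (K + 1))) fun i _ => hanti (by omega)
      simpa using this
    have h2 : 2 ^ N * q (2 ^ N * (K + 1)) ≤ ∑ i ∈ Finset.range (2 ^ N), q (2 ^ N * K + i) := by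
      have := Finset.card_nsmul_le_sum (Finset.range (2 ^ N)) (fun i => q (2 ^ N * K + i))
        (q (2 ^ N * (K + 1))) fun i hi => hanti (by
          have := Finset.mem_range.1 hi
          rw [mul_add_one]
          omega)
      simpa using this
    have h3 : weightSum q (2 ^ N * (K + 1)) = weightSum q (2 ^ N * K) +
        ∑ i ∈ Finset.range (2 ^ N), q (2 ^ N * K + i) := by
      rw [mul_add_one, weightSum, Finset.sum_range_add, weightSum]
    have h4 : (2 : ℝ) ^ v * q (2 ^ N * (K + 1)) = 2 ^ v / 2 ^ N * (2 ^ N * q (2 ^ N * (K + 1))) := by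
      field_simp
    have h5 := mul_le_mul_of_nonneg_left h2 (show (0 : ℝ) ≤ 2 ^ v / 2 ^ N by positivity)
    have h6 := mul_add ((2 : ℝ) ^ v / 2 ^ N) (weightSum q (2 ^ N * K))
      (∑ i ∈ Finset.range (2 ^ N), q (2 ^ N * K + i))
    rw [h3]
    linarith

/-! ### Nörlund means of atoms -/

theorem partialSum_zero (f : ℝ → ℝ) (x : ℝ) : partialSum 0 f x = 0 := by simp [partialSum]

theorem norlundMean_eq (q : ℕ → ℝ) (n : ℕ) (f : ℝ → ℝ) (x : ℝ) :
    norlundMean q n f x =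
      (∑ k ∈ Finset.range (n + 1), q (n - k) * partialSum k f x) / weightSum q n := by
  rw [norlundMean, Finset.sum_range_succ', partialSum_zero, mul_zero, add_zero,
    Finset.range_eq_Ico, Finset.sum_Ico_add' (fun k => q (n - k) * partialSum k f x) 0 n 1,
    one_div, inv_mul_eq_div]
  rfl

/-- A bounded function with mean zero that is supported in a dyadic interval. -/
structure IsAtom (b : ℝ → ℝ) (N J : ℕ) (A : ℝ) : Prop where
  measurable : Measurable b
  bound : ∀ x, |b x| ≤ A
  support : ∀ x, cell N x ≠ J → b x = 0
  mean : ∫ x, b x ∂unitMeasure = 0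

namespace IsAtom

variable {b : ℝ → ℝ} {N J : ℕ} {A : ℝ}

theorem nonneg (h : IsAtom b N J A) : 0 ≤ A := (abs_nonneg _).trans (h.bound 0)

theorem abs_walshCoeff_le (h : IsAtom b N J A) (hJ : J < 2 ^ N) (i : ℕ) :
    |walshCoeff b i| ≤ A / 2 ^ N := by
  have h1 : |walshCoeff b i| ≤ ∫ x, (cellSet N J).indicator (fun _ => A) x ∂unitMeasure := by
    refine norm_integral_le_of_norm_le (f := fun t => b t * walsh i t)
      ((integrable_const A).indicator (measurableSet_cellSet N J))
      (.of_forall fun x => ?_)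
    rw [Real.norm_eq_abs, abs_mul, abs_walsh, mul_one, indicator_cellSet]
    split_ifs with hc
    · exact h.bound x
    · rw [h.support x hc, abs_zero]
  rw [integral_indicator_const _ (measurableSet_cellSet N J), unitMeasure_real_cellSet hJ] at h1
  rwa [smul_eq_mul, inv_mul_eq_div] at h1

theorem walshCoeff_zero (h : IsAtom b N J A) : walshCoeff b 0 = 0 := by
  simpa [walshCoeff, walsh] using h.mean

/-- On the support of `b` the function `w_l` is constant for `l < 2^N`, so it comes out of the
coefficient integral. -/
theorem walshCoeff_mul_walsh (h : IsAtom b N J A) (k : ℕ) {l : ℕ} (hl : l < 2 ^ N) (x : ℝ) :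
    walshCoeff b (2 ^ N * k + l) * walsh (2 ^ N * k + l) x =
      walshCoeff b (2 ^ N * k) * walsh (2 ^ N * k) x *
        signWalsh l fun j => rad x j * rad (cellPoint N J) j := by
  have h1 : walshCoeff b (2 ^ N * k + l) = walshCoeff b (2 ^ N * k) * walsh l (cellPoint N J) := by
    rw [walshCoeff, walshCoeff, ← integral_mul_const]
    refine integral_congr_ae (.of_forall fun t => ?_)
    by_cases hc : cell N t = J
    · have : walsh l t = walsh l (cellPoint N J) := walsh_congr hl (by rw [hc, cell_cellPoint])
      simp only
      rw [← this, walsh_eq, walsh_eq, walsh_eq, signWalsh_two_pow_mul_add hl]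
      ring
    · simp [h.support t hc]
  rw [h1, signWalsh_mul, walsh_eq (2 ^ N * k + l) x, signWalsh_two_pow_mul_add hl,
    walsh_eq (2 ^ N * k) x, walsh_eq l]
  ring

theorem partialSum_eq (h : IsAtom b N J A) {x : ℝ} {s : ℕ} (hs : s < N)
    (hx : digit x s ≠ digit (cellPoint N J) s) (k : ℕ) {l : ℕ} (hl : l ≤ 2 ^ N) :
    partialSum (2 ^ N * k + l) b x = walshCoeff b (2 ^ N * k) * walsh (2 ^ N * k) x *
        signDirichlet l fun j => rad x j * rad (cellPoint N J) j := by
  have hstep : ∀ k, ∀ l ≤ 2 ^ N, partialSum (2 ^ N * k + l) b x = partialSum (2 ^ N * k) b x +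
      walshCoeff b (2 ^ N * k) * walsh (2 ^ N * k) x *
        signDirichlet l fun j => rad x j * rad (cellPoint N J) j := by
    intro k l hl
    rw [partialSum, Finset.sum_range_add, partialSum, signDirichlet, Finset.mul_sum]
    congr 1
    exact Finset.sum_congr rfl fun i hi =>
      h.walshCoeff_mul_walsh k ((Finset.mem_range.1 hi).trans_le hl) x
  have hD := signDirichlet_two_pow_mul_eq_zero (N := N)
    (r := fun j => rad x j * rad (cellPoint N J) j) hs (rad_mul_rad_eq_neg_one hx) 1
  rw [mul_one] at hD
  have hzero : ∀ k, partialSum (2 ^ N * k) b x = 0 := by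
    intro k
    induction k with
    | zero => simp [partialSum]
    | succ k ih => rw [mul_add_one, hstep k _ le_rfl, ih, hD]; simp
  rw [hstep k l hl, hzero, zero_add]

/-- Splitting the summation index into blocks of length `2^N` reduces each block to a weighted sum
of Dirichlet kernels times a coefficient of size `A / 2^N`. Two complete-block terms and one final
partial block give `3 * 10 = 30`. -/
theorem abs_norlundMean_le (h : IsAtom b N J A) (hJ : J < 2 ^ N) {q : ℕ → ℝ}
    (hpos : ∀ k, 0 < q k) (hanti : Antitone q) {x : ℝ} {s v : ℕ} (hsv : s < v) (hvN : v ≤ N)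
    (hs : digit x s ≠ digit (cellPoint N J) s)
    (hv : v < N → digit x v ≠ digit (cellPoint N J) v) (n : ℕ) :
    |norlundMean q n b x| ≤
      30 * (A / 2 ^ N) * 2 ^ s * (weightSum q (2 ^ v) / weightSum q (2 ^ N)) := by
  set R : ℕ → ℝ := fun j => rad x j * rad (cellPoint N J) j with hR
  set β : ℕ → ℝ := fun k => walshCoeff b (2 ^ N * k) * walsh (2 ^ N * k) x with hβ
  have hA : 0 ≤ A / 2 ^ N := div_nonneg h.nonneg (by positivity)
  have hβle : ∀ k, |β k| ≤ A / 2 ^ N := fun k => by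
    rw [hβ]
    simp only
    rw [abs_mul, abs_walsh, mul_one]
    exact h.abs_walshCoeff_le hJ _
  have hβ0 : β 0 = 0 := by simp [hβ, h.walshCoeff_zero]
  have hQN : 0 < weightSum q (2 ^ N) := weightSum_pos hpos Nat.one_le_two_pow
  have hQv : 0 < weightSum q (2 ^ v) := weightSum_pos hpos Nat.one_le_two_pow
  have hrhs : 0 ≤ 30 * (A / 2 ^ N) * 2 ^ s * (weightSum q (2 ^ v) / weightSum q (2 ^ N)) := by
    positivity
  obtain ⟨K, r, hr, rfl⟩ : ∃ K r, r < 2 ^ N ∧ n = 2 ^ N * K + r :=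
    ⟨n / 2 ^ N, n % 2 ^ N, Nat.mod_lt _ (Nat.two_pow_pos N), (Nat.div_add_mod _ _).symm⟩
  have hweighted : ∀ L < 2 ^ N, ∀ c, |∑ l ∈ Finset.range (L + 1), q (c + L - l) *
      signDirichlet l R| ≤ 10 * 2 ^ s * ∑ i ∈ Finset.range (2 ^ v), q (c + i) := fun L hL c =>
    abs_weighted_signDirichlet_le (r := R) hpos hanti (fun j => abs_rad_mul_rad _ _ _) hsv hvN
      (rad_mul_rad_eq_neg_one hs) (fun h' => rad_mul_rad_eq_neg_one (hv h')) hL c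
  have hps : ∀ k, ∀ l ≤ 2 ^ N, partialSum (2 ^ N * k + l) b x = β k * signDirichlet l R :=
    fun k l hl => h.partialSum_eq (hsv.trans_le hvN) hs k hl
  have hlast : |∑ l ∈ Finset.range (r + 1),
      q (2 ^ N * K + r - (2 ^ N * K + l)) * partialSum (2 ^ N * K + l) b x| ≤
      |β K| * (10 * 2 ^ s * weightSum q (2 ^ v)) := by
    have := hweighted r hr 0
    simp only [zero_add] at this
    have e : ∑ l ∈ Finset.range (r + 1),
        q (2 ^ N * K + r - (2 ^ N * K + l)) * partialSum (2 ^ N * K + l) b x =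
        β K * ∑ l ∈ Finset.range (r + 1), q (r - l) * signDirichlet l R := by
      rw [Finset.mul_sum]
      refine Finset.sum_congr rfl fun l hl => ?_
      have := Finset.mem_range.1 hl
      rw [hps K l (by omega), Nat.add_sub_add_left]
      ring
    rw [e, abs_mul]
    exact mul_le_mul_of_nonneg_left this (abs_nonneg _)
  -- Here mean zero is essential: for `n < 2^N` the whole mean vanishes, so no comparison of `Q_n`
  -- with `Q_{2^N}` is needed.
  rcases K with _ | K
  · have : norlundMean q (2 ^ N * 0 + r) b x = 0 := by
      rw [norlundMean_eq, show 2 ^ N * 0 + r + 1 = 2 ^ N * 0 + (r + 1) by omega,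
        Finset.sum_range_add]
      rw [hβ0, abs_zero, zero_mul] at hlast
      rw [abs_nonpos_iff.1 hlast]
      simp
    rw [this, abs_zero]
    exact hrhs
  · have hblock : ∀ k < K + 1, |∑ l ∈ Finset.range (2 ^ N),
        q (2 ^ N * (K + 1) + r - (2 ^ N * k + l)) * partialSum (2 ^ N * k + l) b x| ≤
        A / 2 ^ N * (10 * 2 ^ s *
          ∑ i ∈ Finset.range (2 ^ v), q (2 ^ N * (K + 1 - 1 - k) + i)) := by
      intro k hk
      obtain ⟨j, rfl⟩ : ∃ j, K = k + j := ⟨K - k, by omega⟩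
      have h2N := Nat.two_pow_pos N
      -- A full block ends at `l = 2^N - 1`, where the weight index is exactly `2^N * j + r + 1`.
      have := hweighted (2 ^ N - 1) (by omega) (2 ^ N * j + r + 1)
      rw [Nat.sub_add_cancel h2N] at this
      have e : ∑ l ∈ Finset.range (2 ^ N),
          q (2 ^ N * (k + j + 1) + r - (2 ^ N * k + l)) * partialSum (2 ^ N * k + l) b x =
          β k * ∑ l ∈ Finset.range (2 ^ N), q (2 ^ N * j + r + 1 + (2 ^ N - 1) - l) *
            signDirichlet l R := by
        rw [Finset.mul_sum]
        refine Finset.sum_congr rfl fun l hl => ?_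
        have hl := Finset.mem_range.1 hl
        have : 2 ^ N * (k + j + 1) + r - (2 ^ N * k + l) =
            2 ^ N * j + r + 1 + (2 ^ N - 1) - l := by
          rw [show 2 ^ N * (k + j + 1) = 2 ^ N * k + 2 ^ N * j + 2 ^ N by ring]
          omega
        rw [hps k l hl.le, this]
        ring
      rw [e, abs_mul]
      refine mul_le_mul (hβle k) (this.trans ?_) (abs_nonneg _) hA
      refine mul_le_mul_of_nonneg_left (Finset.sum_le_sum fun i _ => hanti ?_) (by positivity)
      rw [show k + j + 1 - 1 - k = j by omega]
      omega
    have hsum : |∑ k ∈ Finset.range (2 ^ N * (K + 1) + r + 1),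
        q (2 ^ N * (K + 1) + r - k) * partialSum k b x| ≤
        A / 2 ^ N * (10 * 2 ^ s * (weightSum q (2 ^ v) + 2 ^ v / 2 ^ N * weightSum q (2 ^ N * K))) +
          A / 2 ^ N * (10 * 2 ^ s * weightSum q (2 ^ v)) := by
      rw [add_assoc (2 ^ N * (K + 1)), Finset.sum_range_add, sum_range_mul_eq]
      refine (abs_add_le _ _).trans (add_le_add ?_ (hlast.trans
        (mul_le_mul_of_nonneg_right (hβle _) (by positivity))))
      refine (Finset.abs_sum_le_sum_abs _ _).trans
        ((Finset.sum_le_sum fun k hk => hblock k (Finset.mem_range.1 hk)).trans ?_)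
      rw [← Finset.mul_sum, ← Finset.mul_sum, Finset.sum_range_reflect
        (fun j => ∑ i ∈ Finset.range (2 ^ v), q (2 ^ N * j + i)) (K + 1)]
      gcongr
      exact sum_block_weights_le hanti N v K
    have hn0 : 2 ^ N ≤ 2 ^ N * (K + 1) + r := by
      rw [mul_add_one]
      omega
    set n := 2 ^ N * (K + 1) + r
    have hQn : weightSum q (2 ^ N) ≤ weightSum q n := weightSum_mono hpos hn0
    have hQK : weightSum q (2 ^ N * K) ≤ weightSum q n :=
      weightSum_mono hpos (by simp only [n, mul_add_one]; omega)
    have hratio : 2 ^ v / 2 ^ N ≤ weightSum q (2 ^ v) / weightSum q (2 ^ N) := by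
      rw [div_le_div_iff₀ (by positivity) hQN, mul_comm (weightSum q (2 ^ v))]
      exact weightSum_two_pow_le hanti hvN
    rw [norlundMean_eq, abs_div, abs_of_pos (hQN.trans_le hQn), div_le_iff₀ (hQN.trans_le hQn)]
    refine hsum.trans ?_
    have h1 : weightSum q (2 ^ v) ≤
        weightSum q (2 ^ v) / weightSum q (2 ^ N) * weightSum q n := by
      rw [div_mul_eq_mul_div, le_div_iff₀ hQN]
      gcongr
    have h2 : 2 ^ v / 2 ^ N * weightSum q (2 ^ N * K) ≤
        weightSum q (2 ^ v) / weightSum q (2 ^ N) * weightSum q n :=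
      mul_le_mul hratio hQK (weightSum_nonneg hpos _) (by positivity)
    set X := weightSum q (2 ^ v) / weightSum q (2 ^ N) * weightSum q n
    calc _ ≤ A / 2 ^ N * (10 * 2 ^ s * (X + X)) + A / 2 ^ N * (10 * 2 ^ s * X) := by gcongr
      _ = 30 * (A / 2 ^ N) * 2 ^ s * X := by ring
      _ = _ := by simp only [X]; ring

end IsAtom

/-- Two points in different cells have a first and, possibly, a second differing digit. -/
theorem exists_first_two_digits_ne {x y : ℝ} (hx : x ∈ Set.Ico (0 : ℝ) 1)
    (hy : y ∈ Set.Ico (0 : ℝ) 1) {N : ℕ} (h : cell N x ≠ cell N y) :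
    ∃ s v, s < v ∧ v ≤ N ∧ digit x s ≠ digit y s ∧ (v < N → digit x v ≠ digit y v) ∧
      ∀ j < v, j ≠ s → digit x j = digit y j := by
  classical
  have hex : ∃ j, j < N ∧ digit x j ≠ digit y j := by
    by_contra! hc
    exact h (cell_eq_of_digit_eq hx hy hc)
  obtain ⟨hsN, hs⟩ := Nat.find_spec hex
  set s := Nat.find hex
  have hmin : ∀ j < s, digit x j = digit y j := fun j hj => by
    by_contra hc
    exact Nat.find_min hex hj ⟨hj.trans hsN, hc⟩
  have hex2 : ∃ v, s < v ∧ (v = N ∨ digit x v ≠ digit y v) := ⟨N, hsN, Or.inl rfl⟩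
  obtain ⟨hsv, hv⟩ := Nat.find_spec hex2
  have hvN : Nat.find hex2 ≤ N := Nat.find_min' hex2 ⟨hsN, Or.inl rfl⟩
  refine ⟨s, Nat.find hex2, hsv, hvN, hs, fun hlt => hv.resolve_left hlt.ne, fun j hj hjs => ?_⟩
  rcases lt_or_gt_of_ne hjs with hlt | hgt
  · exact hmin j hlt
  · by_contra hc
    exact Nat.find_min hex2 hj ⟨hgt, Or.inr hc⟩

/-- Digits have two values, so differing from `y` at `s` also fixes that digit. If no such point
exists, the index 0 is a vacuous choice. -/
theorem exists_cell_of_digits (y : ℝ) (s v : ℕ) : ∃ c < 2 ^ v, ∀ x ∈ Set.Ico (0 : ℝ) 1,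
    digit x s ≠ digit y s → (∀ j < v, j ≠ s → digit x j = digit y j) → cell v x = c := by
  by_cases h : ∃ x ∈ Set.Ico (0 : ℝ) 1, digit x s ≠ digit y s ∧
      ∀ j < v, j ≠ s → digit x j = digit y j
  · obtain ⟨x₀, hx₀, hs₀, h₀⟩ := h
    refine ⟨cell v x₀, cell_lt hx₀ v, fun x hx hs h => cell_eq_of_digit_eq hx hx₀ fun j hj => ?_⟩
    by_cases hjs : j = s
    · subst hjs
      have := digit_lt_two x j
      have := digit_lt_two x₀ j
      have := digit_lt_two y j
      omega
    · rw [h j hj hjs, h₀ j hj hjs]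
  · push Not at h
    refine ⟨0, Nat.two_pow_pos v, fun x hx hs hj => ?_⟩
    obtain ⟨j, hjv, hjs, hne⟩ := h x hx hs
    exact absurd (hj j hjv hjs) hne

/-! ### The `p`-th power integral of the maximal function of an atom -/

theorem norlundMaximal_ae_le {q : ℕ → ℝ} {C : ℝ≥0}
    (hC : ∀ f : ℝ → ℝ, MemLp f ∞ unitMeasure →
      eLpNorm (norlundMaximal q f) ∞ unitMeasure ≤ C * eLpNorm f ∞ unitMeasure)
    {f : ℝ → ℝ} (hf : Measurable f) {A : ℝ} (hA : ∀ x, |f x| ≤ A) :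
    ∀ᵐ x ∂unitMeasure, norlundMaximal q f x ≤ C * ENNReal.ofReal A := by
  have h1 : eLpNorm f ∞ unitMeasure ≤ ENNReal.ofReal A := by
    rw [eLpNorm_exponent_top]
    exact eLpNormEssSup_le_of_ae_bound (.of_forall hA)
  have h2 := (hC f ⟨hf.aestronglyMeasurable, h1.trans_lt ENNReal.ofReal_lt_top⟩).trans
    (mul_le_mul_right h1 _)
  rw [eLpNorm_exponent_top] at h2
  filter_upwards [enorm_ae_le_eLpNormEssSup (norlundMaximal q f) unitMeasure] with x hx
  exact (enorm_eq_self (norlundMaximal q f x)).ge.trans (hx.trans h2)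

theorem sum_two_pow_rpow_le {p : ℝ} (hp : 0 < p) (v : ℕ) :
    ∑ s ∈ Finset.range v, ((2 : ℝ) ^ s) ^ p ≤ ((2 : ℝ) ^ v) ^ p / (2 ^ p - 1) := by
  have h1 : (1 : ℝ) < 2 ^ p := Real.one_lt_rpow one_lt_two hp
  have h2 : ∀ s : ℕ, ((2 : ℝ) ^ s) ^ p = (2 ^ p) ^ s := fun s => by
    rw [← Real.rpow_natCast, ← Real.rpow_natCast, ← Real.rpow_mul two_pos.le,
      ← Real.rpow_mul two_pos.le, mul_comm]
  simp only [h2]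
  rw [geom_sum_eq h1.ne']
  exact div_le_div_of_nonneg_right (by linarith) (by linarith)

/-- The sequence whose boundedness characterizes the boundedness of `t^*` on `H_p`. -/
def hardyQuantity (q : ℕ → ℝ) (p : ℝ) (N : ℕ) : ℝ :=
  (2 : ℝ) ^ ((N : ℝ) * (1 - p)) / weightSum q (2 ^ N) ^ p *
    ∑ j ∈ Finset.Icc 1 N, weightSum q (2 ^ j) ^ p * (2 : ℝ) ^ ((j : ℝ) * (p - 1))

/-- For fixed `v` the sum over `s` is geometric and costs `2^{vp} / (2^p - 1)`; together with the
measure `2^{-v}` this leaves the factor `2^{v(p-1)}` of the criterion. -/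
theorem sum_atom_bounds_le {q : ℕ → ℝ} (hpos : ∀ k, 0 < q k) {p : ℝ} (hp : 0 < p) {A : ℝ}
    (hA : 0 ≤ A) (N : ℕ) :
    ∑ v ∈ Finset.Icc 1 N, ∑ s ∈ Finset.range v,
      (30 * (A / 2 ^ N) * 2 ^ s * (weightSum q (2 ^ v) / weightSum q (2 ^ N))) ^ p * (2 ^ v)⁻¹ ≤
    30 ^ p / (2 ^ p - 1) * hardyQuantity q p N * A ^ p * (2 ^ N)⁻¹ := by
  have hQ : ∀ n, 0 < weightSum q (2 ^ n) := fun n => weightSum_pos hpos Nat.one_le_two_pow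
  have h1 : (1 : ℝ) < 2 ^ p := Real.one_lt_rpow one_lt_two hp
  have hstep : ∀ v ∈ Finset.Icc 1 N, ∑ s ∈ Finset.range v,
      (30 * (A / 2 ^ N) * 2 ^ s * (weightSum q (2 ^ v) / weightSum q (2 ^ N))) ^ p * (2 ^ v)⁻¹ ≤
      30 ^ p * A ^ p / (((2 : ℝ) ^ N) ^ p * weightSum q (2 ^ N) ^ p * (2 ^ p - 1)) *
        (weightSum q (2 ^ v) ^ p * (2 : ℝ) ^ ((v : ℝ) * (p - 1))) := by
    intro v _
    have e : ∀ s ∈ Finset.range v,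
        (30 * (A / 2 ^ N) * 2 ^ s * (weightSum q (2 ^ v) / weightSum q (2 ^ N))) ^ p * (2 ^ v)⁻¹ =
        30 ^ p * A ^ p / (((2 : ℝ) ^ N) ^ p * weightSum q (2 ^ N) ^ p) * weightSum q (2 ^ v) ^ p *
          (2 ^ v)⁻¹ * ((2 : ℝ) ^ s) ^ p := by
      intro s _
      have := hQ v
      have := hQ N
      rw [Real.mul_rpow (by positivity) (by positivity),
        Real.mul_rpow (by positivity) (by positivity),
        Real.mul_rpow (by positivity) (by positivity), Real.div_rpow hA (by positivity),
        Real.div_rpow (by positivity) (by positivity)]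
      field_simp
    rw [Finset.sum_congr rfl e, ← Finset.mul_sum]
    have e2 : (2 : ℝ) ^ ((v : ℝ) * (p - 1)) = ((2 : ℝ) ^ v) ^ p * (2 ^ v)⁻¹ := by
      rw [mul_sub, mul_one, Real.rpow_sub two_pos, Real.rpow_mul two_pos.le, Real.rpow_natCast,
        div_eq_mul_inv]
    have := hQ v
    have := hQ N
    refine (mul_le_mul_of_nonneg_left (sum_two_pow_rpow_le hp v) (by positivity)).trans_eq ?_
    rw [e2]
    have : (2 : ℝ) ^ p - 1 ≠ 0 := by linarith
    field_simp
  refine (Finset.sum_le_sum hstep).trans_eq ?_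
  rw [← Finset.mul_sum, hardyQuantity]
  have e3 : (2 : ℝ) ^ ((N : ℝ) * (1 - p)) = 2 ^ N / ((2 : ℝ) ^ N) ^ p := by
    rw [mul_sub, mul_one, Real.rpow_sub two_pos, Real.rpow_mul two_pos.le, Real.rpow_natCast]
  rw [e3]
  have := hQ N
  have : (2 : ℝ) ^ p - 1 ≠ 0 := by linarith
  generalize ∑ j ∈ Finset.Icc 1 N, weightSum q (2 ^ j) ^ p * (2 : ℝ) ^ ((j : ℝ) * (p - 1)) = S
  field_simp

theorem exists_lintegral_atom_le {q : ℕ → ℝ} (hpos : ∀ k, 0 < q k) (hanti : Antitone q)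
    (hinf : MaximalBoundedLInfty q) {p : ℝ} (hp : 0 < p)
    (hbdd : BddAbove (Set.range (hardyQuantity q p))) :
    ∃ C : ℝ≥0, ∀ (b : ℝ → ℝ) (N J : ℕ) (A : ℝ), J < 2 ^ N → IsAtom b N J A →
      ∫⁻ x, norlundMaximal q b x ^ p ∂unitMeasure ≤
        C * ENNReal.ofReal (A ^ p) * ENNReal.ofReal (2 ^ N)⁻¹ := by
  obtain ⟨C₀, hC₀⟩ := hinf
  obtain ⟨K, hK⟩ := hbdd
  have hK : ∀ N, hardyQuantity q p N ≤ K := fun N => hK ⟨N, rfl⟩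
  have h1 : (1 : ℝ) < 2 ^ p := Real.one_lt_rpow one_lt_two hp
  refine ⟨C₀ ^ p + (30 ^ p / (2 ^ p - 1) * K).toNNReal, fun b N J A hJ hb => ?_⟩
  have hA := hb.nonneg
  choose c hc hcell using fun s v => exists_cell_of_digits (cellPoint N J) s v
  set B : ℕ → ℕ → ℝ := fun s v =>
    30 * (A / 2 ^ N) * 2 ^ s * (weightSum q (2 ^ v) / weightSum q (2 ^ N)) with hB
  have hB0 : ∀ s v, 0 ≤ B s v := fun s v => by
    have := weightSum_nonneg hpos (2 ^ v)
    have := weightSum_nonneg hpos (2 ^ N)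
    simp only [hB]
    positivity
  -- Off the support, one summand, for the pair `(s, v)` of `x`, already dominates.
  have hpt : ∀ᵐ x ∂unitMeasure, norlundMaximal q b x ^ p ≤
      (cellSet N J).indicator (fun _ => (C₀ * ENNReal.ofReal A) ^ p) x +
      ∑ v ∈ Finset.Icc 1 N, ∑ s ∈ Finset.range v,
        (cellSet v (c s v)).indicator (fun _ => ENNReal.ofReal (B s v ^ p)) x := by
    filter_upwards [norlundMaximal_ae_le hC₀ hb.measurable hb.bound, ae_mem_unit] with x hx hx1
    by_cases hxJ : cell N x = J
    · rw [indicator_cellSet, if_pos hxJ]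
      exact (ENNReal.rpow_le_rpow hx hp.le).trans le_self_add
    · have hne : cell N x ≠ cell N (cellPoint N J) := by rwa [cell_cellPoint]
      obtain ⟨s, v, hsv, hvN, hs, hv, hagree⟩ :=
        exists_first_two_digits_ne hx1 (cellPoint_mem hJ) hne
      have hle : norlundMaximal q b x ≤ ENNReal.ofReal (B s v) := by
        refine iSup₂_le fun n _ => ?_
        rw [Real.enorm_eq_ofReal_abs]
        exact ENNReal.ofReal_le_ofReal (hb.abs_norlundMean_le hJ hpos hanti hsv hvN hs hv n)
      have hle' : norlundMaximal q b x ^ p ≤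
          (cellSet v (c s v)).indicator (fun _ => ENNReal.ofReal (B s v ^ p)) x := by
        rw [indicator_cellSet, if_pos (hcell s v x hx1 hs hagree),
          ← ENNReal.ofReal_rpow_of_nonneg (hB0 s v) hp.le]
        exact ENNReal.rpow_le_rpow hle hp.le
      refine hle'.trans (le_add_left ?_)
      refine le_trans ?_ (Finset.single_le_sum (f := fun v => ∑ s ∈ Finset.range v,
        (cellSet v (c s v)).indicator (fun _ => ENNReal.ofReal (B s v ^ p)) x)
        (fun _ _ => zero_le) (Finset.mem_Icc.2 ⟨by omega, hvN⟩))
      exact Finset.single_le_sum (f := fun s =>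
        (cellSet v (c s v)).indicator (fun _ => ENNReal.ofReal (B s v ^ p)) x)
        (fun _ _ => zero_le) (Finset.mem_range.2 hsv)
  refine (lintegral_mono_ae hpt).trans ?_
  have hmeas : ∀ (n k : ℕ) (a : ℝ≥0∞), Measurable ((cellSet n k).indicator fun _ => a) :=
    fun n k a => measurable_const.indicator (measurableSet_cellSet n k)
  rw [lintegral_add_left (hmeas _ _ _), lintegral_finsetSum _ fun v _ =>
    Finset.measurable_sum _ fun s _ => hmeas _ _ _]
  simp only [lintegral_finsetSum _ fun s _ => hmeas _ _ _,
    lintegral_indicator_const (measurableSet_cellSet _ _), unitMeasure_cellSet hJ,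
    unitMeasure_cellSet (hc _ _)]
  have hsum : ∑ v ∈ Finset.Icc 1 N, ∑ s ∈ Finset.range v,
      ENNReal.ofReal (B s v ^ p) * ENNReal.ofReal (2 ^ v)⁻¹ =
      ENNReal.ofReal (∑ v ∈ Finset.Icc 1 N, ∑ s ∈ Finset.range v, B s v ^ p * (2 ^ v)⁻¹) := by
    have h0 : ∀ s v, 0 ≤ B s v ^ p * ((2 : ℝ) ^ v)⁻¹ := fun s v =>
      mul_nonneg (Real.rpow_nonneg (hB0 s v) p) (by positivity)
    rw [ENNReal.ofReal_sum_of_nonneg fun v _ => Finset.sum_nonneg fun s _ => h0 s v]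
    refine Finset.sum_congr rfl fun v _ => ?_
    rw [ENNReal.ofReal_sum_of_nonneg fun s _ => h0 s v]
    exact Finset.sum_congr rfl fun s _ =>
      (ENNReal.ofReal_mul (Real.rpow_nonneg (hB0 s v) p)).symm
  rw [hsum, ENNReal.coe_add, add_mul, add_mul]
  refine add_le_add ?_ ?_
  · rw [ENNReal.mul_rpow_of_nonneg _ _ hp.le, ENNReal.ofReal_rpow_of_nonneg hA hp.le,
      ENNReal.coe_rpow_of_nonneg _ hp.le]
  · refine (ENNReal.ofReal_le_ofReal (sum_atom_bounds_le hpos hp hA N)).trans ?_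
    have hAp : 0 ≤ A ^ p := Real.rpow_nonneg hA p
    rw [ENNReal.ofReal_mul' (by positivity), ENNReal.ofReal_mul' hAp]
    gcongr
    refine ENNReal.ofReal_le_ofReal (mul_le_mul_of_nonneg_left (hK N) ?_)
    exact div_nonneg (by positivity) (by linarith)

/-! ### Maximal functions on the dyadic tree -/

/-- The maximum of `v` along the path from the root to the node `c` of level `n`. -/
def pathMax (v : ℕ → ℕ → ℝ) : ℕ → ℕ → ℝ
  | 0, c => v 0 c
  | n + 1, c => max (pathMax v n (c / 2)) (v (n + 1) c)

/-- The maximum of `v` over all children of nodes on the path from the root to the node `c` of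
level `n`. -/
def childMax (v : ℕ → ℕ → ℝ) : ℕ → ℕ → ℝ
  | 0, c => max (v 1 (2 * c)) (v 1 (2 * c + 1))
  | n + 1, c => max (childMax v n (c / 2)) (max (v (n + 2) (2 * c)) (v (n + 2) (2 * c + 1)))

section Tree

variable {v : ℕ → ℕ → ℝ}

theorem le_childMax_child (n c : ℕ) : v (n + 1) c ≤ childMax v n (c / 2) := by
  have : max (v (n + 1) (2 * (c / 2))) (v (n + 1) (2 * (c / 2) + 1)) ≤ childMax v n (c / 2) := by
    cases n with
    | zero => exact le_rfl
    | succ n => exact le_max_right _ _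
  refine le_trans ?_ this
  rcases Nat.mod_two_eq_zero_or_one c with h | h
  · rw [show 2 * (c / 2) = c by omega]; exact le_max_left _ _
  · rw [show 2 * (c / 2) + 1 = c by omega]; exact le_max_right _ _

theorem childMax_nonneg (hv : ∀ n c, 0 ≤ v n c) (n c : ℕ) : 0 ≤ childMax v n c := by
  have := le_childMax_child (v := v) n (2 * c)
  rw [show 2 * c / 2 = c by omega] at this
  exact (hv _ _).trans this

/-- The averaging property is weakened to domination by the larger child because this form survives
`p`-th powers with `p < 1`. -/
theorem le_childMax
    (hmean : ∀ n c, v n c ≤ max (v (n + 1) (2 * c)) (v (n + 1) (2 * c + 1)))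
    (n c : ℕ) : v n c ≤ childMax v n c := by
  refine (hmean n c).trans ?_
  cases n with
  | zero => exact le_rfl
  | succ n => exact le_max_right _ _

theorem pathMax_succ_le_childMax
    (hmean : ∀ n c, v n c ≤ max (v (n + 1) (2 * c)) (v (n + 1) (2 * c + 1)))
    (n c : ℕ) : pathMax v (n + 1) c ≤ childMax v n (c / 2) := by
  induction n generalizing c with
  | zero => exact max_le (le_childMax hmean 0 _) (le_childMax_child 0 c)
  | succ n ih => exact max_le ((ih _).trans (le_max_left _ _)) (le_childMax_child _ c)

/-- The averages of the two maximal functions are comparable. -/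
theorem sum_childMax_le
    (hmean : ∀ n c, v n c ≤ max (v (n + 1) (2 * c)) (v (n + 1) (2 * c + 1)))
    (hv : ∀ n c, 0 ≤ v n c) (n : ℕ) :
    ∑ c ∈ Finset.range (2 ^ n), childMax v n c ≤
      ∑ c ∈ Finset.range (2 ^ (n + 1)), pathMax v (n + 1) c := by
  induction n with
  | zero =>
    have h1 := hv 1 0
    have h2 := hv 1 1
    simp only [pow_zero, Finset.sum_range_one, childMax, zero_add, pow_one,
      Finset.sum_range_succ, pathMax]
    refine max_le ?_ ?_
    · have := le_max_right (v 0 (0 / 2)) (v 1 0)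
      have := le_max_right (v 0 (1 / 2)) (v 1 1)
      simp only [mul_zero]
      linarith
    · have := le_max_right (v 0 (0 / 2)) (v 1 0)
      have := le_max_right (v 0 (1 / 2)) (v 1 1)
      simp only [mul_zero, zero_add]
      linarith
  | succ n ih =>
    -- A jump at one child is charged to the growth of `pathMax` at that child. Summed over `c`, the
    -- terms of level `n + 1` are absorbed by the induction hypothesis.
    have hpt : ∀ c, childMax v (n + 1) c ≤ childMax v n (c / 2) +
        (pathMax v (n + 2) (2 * c) + pathMax v (n + 2) (2 * c + 1)) -
          2 * pathMax v (n + 1) c := by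
      intro c
      have h := pathMax_succ_le_childMax hmean n c
      have e1 : pathMax v (n + 2) (2 * c) = max (pathMax v (n + 1) c) (v (n + 1 + 1) (2 * c)) := by
        rw [pathMax, show 2 * c / 2 = c by omega]
      have e2 : pathMax v (n + 2) (2 * c + 1) =
          max (pathMax v (n + 1) c) (v (n + 1 + 1) (2 * c + 1)) := by
        rw [pathMax, show (2 * c + 1) / 2 = c by omega]
      rw [childMax, e1, e2]
      have h1 := le_max_left (pathMax v (n + 1) c) (v (n + 1 + 1) (2 * c))
      have h2 := le_max_right (pathMax v (n + 1) c) (v (n + 1 + 1) (2 * c))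
      have h3 := le_max_left (pathMax v (n + 1) c) (v (n + 1 + 1) (2 * c + 1))
      have h4 := le_max_right (pathMax v (n + 1) c) (v (n + 1 + 1) (2 * c + 1))
      refine max_le (by linarith) (max_le ?_ ?_) <;> linarith
    refine (Finset.sum_le_sum fun c _ => hpt c).trans ?_
    rw [Finset.sum_sub_distrib, Finset.sum_add_distrib, ← sum_range_two_pow_succ (n + 1),
      sum_range_two_pow_succ n fun c => childMax v n (c / 2), ← Finset.mul_sum]
    have : ∑ c ∈ Finset.range (2 ^ n),
        (childMax v n (2 * c / 2) + childMax v n ((2 * c + 1) / 2)) =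
        2 * ∑ c ∈ Finset.range (2 ^ n), childMax v n c := by
      rw [Finset.mul_sum]
      refine Finset.sum_congr rfl fun c _ => ?_
      rw [show 2 * c / 2 = c by omega, show (2 * c + 1) / 2 = c by omega]
      ring
    rw [this]
    linarith

end Tree

theorem max_rpow {a b p : ℝ} (ha : 0 ≤ a) (hb : 0 ≤ b) (hp : 0 ≤ p) :
    max a b ^ p = max (a ^ p) (b ^ p) := by
  rcases le_total a b with h | h
  · rw [max_eq_right h, max_eq_right (Real.rpow_le_rpow ha h hp)]
  · rw [max_eq_left h, max_eq_left (Real.rpow_le_rpow hb h hp)]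

theorem childMax_rpow {v : ℕ → ℕ → ℝ} (hv : ∀ n c, 0 ≤ v n c) {p : ℝ} (hp : 0 ≤ p) (n c : ℕ) :
    childMax v n c ^ p = childMax (fun n c => v n c ^ p) n c := by
  induction n generalizing c with
  | zero => exact max_rpow (hv _ _) (hv _ _) hp
  | succ n ih =>
    rw [childMax, childMax, max_rpow (childMax_nonneg hv _ _) (le_max_of_le_left (hv _ _)) hp,
      max_rpow (hv _ _) (hv _ _) hp, ih]

/-! ### Rounding up to powers of two -/

/-- Zero, or the least integral power of two that exceeds `x`. -/
def roundUp (x : ℝ) : ℝ := if 0 < x then (2 : ℝ) ^ (Int.log 2 x + 1) else 0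

theorem roundUp_nonneg (x : ℝ) : 0 ≤ roundUp x := by
  unfold roundUp; split_ifs <;> positivity

theorem le_roundUp (x : ℝ) : x ≤ roundUp x := by
  unfold roundUp
  split_ifs with h
  · exact_mod_cast (Int.lt_zpow_succ_log_self one_lt_two x).le
  · exact not_lt.1 h

theorem roundUp_le {x : ℝ} (hx : 0 ≤ x) : roundUp x ≤ 2 * x := by
  unfold roundUp
  split_ifs with h
  · rw [zpow_add_one₀ two_ne_zero, mul_comm]
    have := Int.zpow_log_le_self (b := 2) one_lt_two h
    push_cast at this
    linarith
  · linarith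

theorem roundUp_mono : Monotone roundUp := by
  intro x y hxy
  unfold roundUp
  split_ifs with h1 h2
  · exact zpow_le_zpow_right₀ one_le_two (add_le_add_left (Int.log_mono_right h1 hxy) 1)
  · exact absurd (h1.trans_le hxy) h2
  · positivity
  · exact le_rfl

/-- Distinct rounded values differ by a factor of at least 2, which makes sums of atom heights
geometric. -/
theorem two_mul_roundUp_le {x y : ℝ} (h : roundUp x < roundUp y) :
    2 * roundUp x ≤ roundUp y := by
  unfold roundUp at *
  split_ifs at * with h1 h2
  · have := (zpow_lt_zpow_iff_right₀ (one_lt_two : (1 : ℝ) < 2)).1 h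
    rw [mul_comm, ← zpow_add_one₀ two_ne_zero]
    exact zpow_le_zpow_right₀ one_le_two (by omega)
  · exact absurd h (not_lt.2 (by positivity))
  · rw [mul_zero]; positivity
  · simp

/-! ### Grouping the increments of a sequence -/

/-- The sequence `g` takes at `n` a value different from the preceding one. -/
def IsNew (g : ℕ → ℝ) (n : ℕ) : Prop := n = 0 ∨ g (n - 1) ≠ g n

open Classical in
/-- The sum of the increments of `a` from `n` to `m` as long as `g` keeps its value. -/
def constancySum (a g : ℕ → ℝ) (n m : ℕ) : ℝ :=
  ∑ i ∈ Finset.Ico n m, if g i = g n then a (i + 1) - a i else 0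

/-- The sum telescopes to `a k - a n`, where `k` is at most one step past the last index with `g = g
n`. Predictability `ha'` bounds `a k` even when `g` has just jumped. -/
theorem abs_constancySum_le {a g : ℕ → ℝ} (hg : Monotone g) (ha : ∀ i, |a i| ≤ g i)
    (ha' : ∀ i, |a (i + 1)| ≤ g i) {n m : ℕ} (h : n ≤ m) : |constancySum a g n m| ≤ 2 * g n := by
  have key : ∃ k, constancySum a g n m = a k - a n ∧ |a k| ≤ g n := by
    induction m, h using Nat.le_induction with
    | base => exact ⟨n, by simp [constancySum], ha n⟩
    | succ m hm ih =>
      by_cases hgm : g m = g n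
      · refine ⟨m + 1, ?_, hgm ▸ ha' m⟩
        rw [constancySum, ← Finset.sum_Ico_sub a (hm.trans (Nat.le_succ m))]
        refine Finset.sum_congr rfl fun i hi => if_pos ?_
        have := Finset.mem_Ico.1 hi
        exact le_antisymm (hgm ▸ hg (by omega)) (hg this.1)
      · rw [constancySum, Finset.sum_Ico_succ_top hm, if_neg hgm, add_zero]
        exact ih
  obtain ⟨k, hk, hk'⟩ := key
  rw [hk, two_mul]
  exact (abs_sub _ _).trans (add_le_add hk' (ha n))

open Classical in
-- By monotonicity each index lies in exactly one stretch of constancy, and that stretch has one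
-- starting point.
theorem sum_isNew_eq_one {g : ℕ → ℝ} (hg : Monotone g) (m : ℕ) :
    ∑ n ∈ Finset.range (m + 1), (if IsNew g n ∧ g m = g n then (1 : ℝ) else 0) = 1 := by
  induction m with
  | zero => simp [IsNew]
  | succ m ih =>
    rw [Finset.sum_range_succ]
    by_cases h : g m = g (m + 1)
    · rw [if_neg (fun hc => by simp [IsNew, h] at hc), add_zero, ← h]
      exact ih
    · rw [if_pos ⟨Or.inr h, rfl⟩, Finset.sum_eq_zero, zero_add]
      intro n hn
      refine if_neg fun hc => h (le_antisymm (hg (Nat.le_succ m)) ?_)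
      rw [hc.2]
      exact hg (Nat.lt_succ_iff.1 (Finset.mem_range.1 hn))

open Classical in
theorem sum_constancySum {a g : ℕ → ℝ} (hg : Monotone g) (m : ℕ) :
    ∑ n ∈ Finset.range m, (if IsNew g n then constancySum a g n m else 0) = a m - a 0 := by
  induction m with
  | zero => simp
  | succ m ih =>
    have h1 : ∀ n ∈ Finset.range (m + 1), (if IsNew g n then constancySum a g n (m + 1) else 0) =
        (if IsNew g n then constancySum a g n m else 0) +
          (if IsNew g n ∧ g m = g n then (1 : ℝ) else 0) * (a (m + 1) - a m) := by
      intro n hn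
      have hn := Nat.lt_succ_iff.1 (Finset.mem_range.1 hn)
      rw [constancySum, Finset.sum_Ico_succ_top hn, ← constancySum]
      by_cases hN : IsNew g n <;> by_cases hc : g m = g n <;> simp [hN, hc]
    rw [Finset.sum_congr rfl h1, Finset.sum_add_distrib, ← Finset.sum_mul, sum_isNew_eq_one hg,
      Finset.sum_range_succ, ih]
    simp [constancySum]

open Classical in
-- Successive new values at least double, so the sum is dominated by a geometric series ending at `g
-- m ^ p`.
theorem sum_isNew_rpow_le {g : ℕ → ℝ} (hg : Monotone g) (hg0 : ∀ i, 0 ≤ g i)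
    (hgap : ∀ i j, g i < g j → 2 * g i ≤ g j) {p : ℝ} (hp : 0 < p) (m : ℕ) :
    ∑ n ∈ Finset.range (m + 1), (if IsNew g n then g n ^ p else 0) ≤
      2 ^ p / (2 ^ p - 1) * g m ^ p := by
  have h1 : (1 : ℝ) < 2 ^ p := Real.one_lt_rpow one_lt_two hp
  have h0 : (0 : ℝ) < 2 ^ p - 1 := by linarith
  induction m with
  | zero =>
    have : 0 ≤ g 0 ^ p := Real.rpow_nonneg (hg0 0) p
    simp only [zero_add, Finset.sum_range_one, IsNew, true_or, if_true]
    refine le_mul_of_one_le_left this ?_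
    rw [le_div_iff₀ h0]
    linarith
  | succ m ih =>
    rw [Finset.sum_range_succ]
    by_cases h : g m = g (m + 1)
    · rw [if_neg (fun hc => by simp [IsNew, h] at hc), add_zero, ← h]
      exact ih
    · rw [if_pos (show IsNew g (m + 1) from Or.inr h)]
      have h2 := hgap m (m + 1) (lt_of_le_of_ne (hg (Nat.le_succ m)) h)
      have h3 : 2 ^ p * g m ^ p ≤ g (m + 1) ^ p := by
        rw [← Real.mul_rpow two_pos.le (hg0 m)]
        exact Real.rpow_le_rpow (mul_nonneg two_pos.le (hg0 m)) h2 hp.le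
      have h4 : 2 ^ p / (2 ^ p - 1) * g m ^ p ≤ 1 / (2 ^ p - 1) * g (m + 1) ^ p := by
        rw [div_mul_eq_mul_div, div_mul_eq_mul_div, one_mul]
        exact div_le_div_of_nonneg_right h3 h0.le
      have h5 : 2 ^ p / (2 ^ p - 1) * g (m + 1) ^ p =
          1 / (2 ^ p - 1) * g (m + 1) ^ p + g (m + 1) ^ p := by
        field_simp
        ring
      linarith

/-! ### Atomic decomposition -/

/-- `h` is constant on dyadic intervals of level `n`. -/
def CellFun {α : Type*} (n : ℕ) (h : ℝ → α) : Prop := ∀ x y, cell n x = cell n y → h x = h y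

theorem CellFun.eq_comp {α : Type*} {n : ℕ} {h : ℝ → α} (hh : CellFun n h) :
    h = fun x => (fun c => h (cellPoint n c)) (cell n x) :=
  funext fun _ => hh _ _ (cell_cellPoint n _).symm

theorem CellFun.measurable {n : ℕ} {h : ℝ → ℝ} (hh : CellFun n h) : Measurable h := by
  rw [hh.eq_comp]
  exact measurable_comp_cell n fun c => h (cellPoint n c)

/-- The martingale of `f` at the point `x`. -/
def avgSeq (f : ℝ → ℝ) (x : ℝ) (i : ℕ) : ℝ := cellAvg f i (cell i x)

/-- A predictable majorant of the martingale of `f`. -/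
def majorant (f : ℝ → ℝ) (i c : ℕ) : ℝ := childMax (fun n c => |cellAvg f n c|) i c

/-- The majorant at the point `x`, rounded up to powers of two. -/
def majSeq (f : ℝ → ℝ) (x : ℝ) (i : ℕ) : ℝ := roundUp (majorant f i (cell i x))

open Classical in
/-- The atoms of the conditional expectation of `f` at level `m`. -/
def atomFun (f : ℝ → ℝ) (m n J : ℕ) (x : ℝ) : ℝ :=
  if cell n x = J ∧ IsNew (majSeq f x) n then constancySum (avgSeq f x) (majSeq f x) n m else 0

open Classical in
/-- Half the height of an atom. -/
def atomSize (f : ℝ → ℝ) (n : ℕ) (x : ℝ) : ℝ :=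
  if IsNew (majSeq f x) n then majSeq f x n else 0

theorem avgSeq_congr (f : ℝ → ℝ) {m i : ℕ} (hi : i ≤ m) {x y : ℝ} (h : cell m x = cell m y) :
    avgSeq f x i = avgSeq f y i := by
  rw [avgSeq, avgSeq, cell_eq_of_le hi h]

theorem majSeq_congr (f : ℝ → ℝ) {m i : ℕ} (hi : i ≤ m) {x y : ℝ} (h : cell m x = cell m y) :
    majSeq f x i = majSeq f y i := by
  rw [majSeq, majSeq, cell_eq_of_le hi h]

theorem isNew_congr (f : ℝ → ℝ) {m i : ℕ} (hi : i ≤ m) {x y : ℝ} (h : cell m x = cell m y) :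
    IsNew (majSeq f x) i ↔ IsNew (majSeq f y) i := by
  rw [IsNew, IsNew, majSeq_congr f hi h, majSeq_congr f (show i - 1 ≤ m by omega) h]

theorem cellFun_atomSize (f : ℝ → ℝ) (n : ℕ) : CellFun n (atomSize f n) := fun x y h => by
  classical
  rw [atomSize, atomSize, majSeq_congr f le_rfl h]
  exact if_congr (isNew_congr f le_rfl h) rfl rfl

theorem abs_cellAvg_le {f : ℝ → ℝ} (hf : Integrable f unitMeasure) (n c : ℕ) :
    |cellAvg f n c| ≤ max |cellAvg f (n + 1) (2 * c)| |cellAvg f (n + 1) (2 * c + 1)| := by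
  rw [cellAvg_eq hf n c, abs_div, abs_two, div_le_iff₀ two_pos]
  have := abs_add_le (cellAvg f (n + 1) (2 * c)) (cellAvg f (n + 1) (2 * c + 1))
  have := le_max_left |cellAvg f (n + 1) (2 * c)| |cellAvg f (n + 1) (2 * c + 1)|
  have := le_max_right |cellAvg f (n + 1) (2 * c)| |cellAvg f (n + 1) (2 * c + 1)|
  linarith

theorem majorant_nonneg (f : ℝ → ℝ) (i c : ℕ) : 0 ≤ majorant f i c :=
  childMax_nonneg (fun _ _ => abs_nonneg _) i c

theorem monotone_majSeq (f : ℝ → ℝ) (x : ℝ) : Monotone (majSeq f x) :=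
  monotone_nat_of_le_succ fun i => roundUp_mono (by
    rw [← cell_succ_div_two]
    exact le_max_left _ _)

theorem abs_avgSeq_le {f : ℝ → ℝ} (hf : Integrable f unitMeasure) (x : ℝ) (i : ℕ) :
    |avgSeq f x i| ≤ majSeq f x i :=
  (le_childMax (v := fun n c => |cellAvg f n c|) (abs_cellAvg_le hf) i (cell i x)).trans
    (le_roundUp _)

/-- The predictability of the majorant: at level `i` it has already looked at both children. -/
theorem abs_avgSeq_succ_le (f : ℝ → ℝ) (x : ℝ) (i : ℕ) :
    |avgSeq f x (i + 1)| ≤ majSeq f x i := by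
  have := le_childMax_child (v := fun n c => |cellAvg f n c|) i (cell (i + 1) x)
  rw [cell_succ_div_two] at this
  exact this.trans (le_roundUp _)

theorem isAtom_atomFun {f : ℝ → ℝ} (hf : Integrable f unitMeasure) {m n J : ℕ} (h : n ≤ m) :
    IsAtom (atomFun f m n J) n J (2 * atomSize f n (cellPoint n J)) := by
  classical
  refine ⟨CellFun.measurable (n := m) fun x y hxy => ?_, fun x => ?_, fun x hx => ?_, ?_⟩
  · simp only [atomFun, cell_eq_of_le h hxy, isNew_congr f h hxy]
    congr 1
    refine Finset.sum_congr rfl fun i hi => ?_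
    have hi := Finset.mem_Ico.1 hi
    rw [majSeq_congr f hi.2.le hxy, majSeq_congr f h hxy, avgSeq_congr f hi.2.le hxy,
      avgSeq_congr f hi.2 hxy]
  · rw [atomFun]
    split_ifs with hc
    · have hcell : cell n (cellPoint n J) = cell n x := by rw [cell_cellPoint, hc.1]
      rw [cellFun_atomSize f n _ _ hcell, atomSize, if_pos hc.2]
      exact abs_constancySum_le (monotone_majSeq f x) (abs_avgSeq_le hf x) (abs_avgSeq_succ_le f x) h
    · rw [abs_zero, atomSize]
      split_ifs
      · exact mul_nonneg two_pos.le (roundUp_nonneg _)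
      · simp
  · exact if_neg fun hc => hx hc.1
  -- The cut-off is decided at level `i`, hence is orthogonal to the increment from `i` to `i + 1`.
  · let H : ℕ → ℝ → ℝ := fun i x =>
      if cell n x = J ∧ IsNew (majSeq f x) n ∧ majSeq f x i = majSeq f x n then 1 else 0
    have hH : ∀ i, n ≤ i → CellFun i (H i) := fun i hi x y hxy => by
      simp only [H, cell_eq_of_le hi hxy, isNew_congr f hi hxy, majSeq_congr f hi hxy,
        majSeq_congr f le_rfl hxy]
    have hsum : ∀ x, atomFun f m n J x = ∑ i ∈ Finset.Ico n m,
        H i x * (cellAvg f (i + 1) (cell (i + 1) x) - cellAvg f i (cell i x)) := by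
      intro x
      rw [atomFun]
      split_ifs with hc
      · refine Finset.sum_congr rfl fun i _ => ?_
        simp only [H, hc.1, hc.2, true_and, ite_mul, one_mul, zero_mul, avgSeq]
      · refine (Finset.sum_eq_zero fun i _ => ?_).symm
        simp only [H]
        rw [if_neg fun h' => hc ⟨h'.1, h'.2.1⟩, zero_mul]
    simp only [hsum]
    rw [integral_finsetSum]
    · refine Finset.sum_eq_zero fun i hi => ?_
      rw [(hH i (Finset.mem_Ico.1 hi).1).eq_comp]
      exact integral_cellAvg_sub_mul hf i _
    · intro i hi
      refine Integrable.bdd_mul (c := 1)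
        ((integrable_comp_cell (i + 1) _).sub (integrable_comp_cell i _))
        ((hH i (Finset.mem_Ico.1 hi).1).measurable.aestronglyMeasurable) (.of_forall fun x => ?_)
      simp only [H]
      split_ifs <;> simp

theorem cellAvg_eq_sum_atomFun (f : ℝ → ℝ) (m : ℕ) {x : ℝ} (hx : x ∈ Set.Ico (0 : ℝ) 1) :
    cellAvg f m (cell m x) = cellAvg f 0 0 +
      ∑ n ∈ Finset.range m, ∑ J ∈ Finset.range (2 ^ n), atomFun f m n J x := by
  classical
  have h := sum_constancySum (a := avgSeq f x) (monotone_majSeq f x) m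
  have : ∀ n ∈ Finset.range m, ∑ J ∈ Finset.range (2 ^ n), atomFun f m n J x =
      if IsNew (majSeq f x) n then constancySum (avgSeq f x) (majSeq f x) n m else 0 := by
    intro n _
    simp only [atomFun, ite_and]
    rw [Finset.sum_ite_eq, if_pos (Finset.mem_range.2 (cell_lt hx n))]
  rw [Finset.sum_congr rfl this, h, avgSeq, avgSeq, cell_zero hx]
  ring

/-! ### Linearity and measurability of the means -/

theorem norlundMean_eq_add_sum {ι : Type*} (S : Finset ι) {f g : ℝ → ℝ} {b : ι → ℝ → ℝ} {n : ℕ}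
    (h : ∀ i < n, walshCoeff f i = walshCoeff g i + ∑ k ∈ S, walshCoeff (b k) i) (q : ℕ → ℝ)
    (x : ℝ) :
    norlundMean q n f x = norlundMean q n g x + ∑ k ∈ S, norlundMean q n (b k) x := by
  have hps : ∀ M ∈ Finset.Icc 1 n, q (n - M) * partialSum M f x =
      q (n - M) * partialSum M g x + ∑ k ∈ S, q (n - M) * partialSum M (b k) x := by
    intro M hM
    rw [← Finset.mul_sum, ← mul_add]
    congr 1
    simp only [partialSum]
    rw [Finset.sum_comm, ← Finset.sum_add_distrib]
    refine Finset.sum_congr rfl fun i hi => ?_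
    rw [h i ((Finset.mem_range.1 hi).trans_le (Finset.mem_Icc.1 hM).2), add_mul, Finset.sum_mul]
  simp only [norlundMean]
  rw [Finset.sum_congr rfl hps, Finset.sum_add_distrib, mul_add]
  congr 1
  rw [Finset.sum_comm, Finset.mul_sum]

theorem measurable_norlundMean (q : ℕ → ℝ) (n : ℕ) (f : ℝ → ℝ) :
    Measurable (norlundMean q n f) :=
  (Finset.measurable_sum _ fun _ _ => (Finset.measurable_sum _ fun i _ =>
    (measurable_walsh i).const_mul _).const_mul _).const_mul _

theorem measurable_norlundMaximal (q : ℕ → ℝ) (f : ℝ → ℝ) : Measurable (norlundMaximal q f) :=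
  .iSup fun n => .iSup fun _ => (measurable_norlundMean q n f).enorm

theorem sum_rpow_le {ι : Type*} (S : Finset ι) (a : ι → ℝ≥0∞) {p : ℝ} (hp : 0 < p)
    (hp1 : p ≤ 1) : (∑ k ∈ S, a k) ^ p ≤ ∑ k ∈ S, a k ^ p := by
  classical
  induction S using Finset.induction_on with
  | empty => simp [hp]
  | insert k S hk ih =>
    rw [Finset.sum_insert hk, Finset.sum_insert hk]
    exact (ENNReal.rpow_add_le_add_rpow _ _ hp.le hp1).trans (by gcongr)

/-- The maximal operator over the means of order at most `2 ^ m`. -/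
def truncatedMaximal (q : ℕ → ℝ) (m : ℕ) (f : ℝ → ℝ) (x : ℝ) : ℝ≥0∞ :=
  ⨆ n : ℕ, ⨆ _ : 1 ≤ n ∧ n ≤ 2 ^ m, ‖norlundMean q n f x‖ₑ

/-- Means of order at most `2^m` use only coefficients below `2^m`; these agree with those of the
conditional expectation at level `m`, which is a constant plus finitely many atoms. -/
theorem truncatedMaximal_le {f : ℝ → ℝ} (hf : Integrable f unitMeasure) (q : ℕ → ℝ) (m : ℕ)
    (x : ℝ) : truncatedMaximal q m f x ≤ norlundMaximal q (fun _ => cellAvg f 0 0) x +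
      ∑ k ∈ (Finset.range m).sigma fun n => Finset.range (2 ^ n),
        norlundMaximal q (atomFun f m k.1 k.2) x := by
  refine iSup₂_le fun n hn => ?_
  have hint : ∀ k ∈ (Finset.range m).sigma fun n => Finset.range (2 ^ n),
      Integrable (atomFun f m k.1 k.2) unitMeasure := by
    intro k hk
    have hk := (Finset.mem_range.1 (Finset.mem_sigma.1 hk).1).le
    have := isAtom_atomFun hf (J := k.2) hk
    exact Integrable.of_bound this.measurable.aestronglyMeasurable _ (.of_forall this.bound)
  have hcoeff : ∀ i < n, walshCoeff f i = walshCoeff (fun _ => cellAvg f 0 0) i +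
      ∑ k ∈ (Finset.range m).sigma fun n => Finset.range (2 ^ n),
        walshCoeff (atomFun f m k.1 k.2) i := by
    intro i hi
    rw [← walshCoeff_cellAvg hf (hi.trans_le hn.2)]
    simp only [walshCoeff]
    rw [← integral_finsetSum _ fun k hk => integrable_mul_walsh (hint k hk) i,
      ← integral_add (integrable_mul_walsh (integrable_const _) i)
        (integrable_finsetSum _ fun k hk => integrable_mul_walsh (hint k hk) i)]
    refine integral_congr_ae (ae_mem_unit.mono fun t ht => ?_)
    simp only
    rw [cellAvg_eq_sum_atomFun f m ht, add_mul, Finset.sum_sigma, Finset.sum_mul]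
    simp only [Finset.sum_mul]
  rw [norlundMean_eq_add_sum _ hcoeff]
  have hle : ∀ g, ‖norlundMean q n g x‖ₑ ≤ norlundMaximal q g x := fun g =>
    le_iSup₂_of_le n hn.1 le_rfl
  exact (enorm_add_le _ _).trans (add_le_add (hle _) ((enorm_sum_le _ _).trans
    (Finset.sum_le_sum fun k _ => hle _)))

theorem measurable_truncatedMaximal (q : ℕ → ℝ) (m : ℕ) (f : ℝ → ℝ) :
    Measurable (truncatedMaximal q m f) :=
  .iSup fun n => .iSup fun _ => (measurable_norlundMean q n f).enorm

theorem monotone_truncatedMaximal (q : ℕ → ℝ) (f : ℝ → ℝ) :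
    Monotone fun m => truncatedMaximal q m f := fun _ _ hab _ =>
  iSup_mono fun _ => iSup_mono' fun h =>
    ⟨⟨h.1, h.2.trans (Nat.pow_le_pow_right two_pos hab)⟩, le_rfl⟩

/-- The shift to `m + 1` makes the atoms start at levels `0, …, m`, the range controlled by the
majorant at level `m`. -/
theorem norlundMaximal_eq_iSup (q : ℕ → ℝ) (f : ℝ → ℝ) (x : ℝ) :
    norlundMaximal q f x = ⨆ m, truncatedMaximal q (m + 1) f x := by
  refine le_antisymm (iSup₂_le fun n hn => le_iSup_of_le n (le_iSup₂_of_le n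
    ⟨hn, Nat.lt_two_pow_self.le.trans (Nat.pow_le_pow_right two_pos (Nat.le_succ n))⟩ le_rfl))
    (iSup_le fun m => iSup₂_le fun n hn => le_iSup₂_of_le n hn.1 le_rfl)

theorem lintegral_norlundMaximal_rpow (q : ℕ → ℝ) (f : ℝ → ℝ) {p : ℝ} (hp : 0 < p) :
    ∫⁻ x, norlundMaximal q f x ^ p ∂unitMeasure =
      ⨆ m, ∫⁻ x, truncatedMaximal q (m + 1) f x ^ p ∂unitMeasure := by
  rw [← lintegral_iSup]
  · refine lintegral_congr fun x => ?_
    rw [norlundMaximal_eq_iSup]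
    exact (ENNReal.orderIsoRpow p hp).map_iSup _
  · exact fun m => (measurable_truncatedMaximal q (m + 1) f).pow_const p
  · exact fun a b hab x => ENNReal.rpow_le_rpow
      (monotone_truncatedMaximal q f (Nat.succ_le_succ hab) x) hp.le

/-! ### The size of the atomic decomposition -/

theorem abs_avgSeq_le_dyadicMaximal {f : ℝ → ℝ} (hf : Integrable f unitMeasure) {x : ℝ}
    (hx : x ∈ Set.Ico (0 : ℝ) 1) (n : ℕ) :
    ENNReal.ofReal |cellAvg f n (cell n x)| ≤ dyadicMaximal f x := by
  rw [← partialSum_two_pow hf n hx, ← Real.enorm_eq_ofReal_abs]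
  exact le_iSup (fun n => ‖partialSum (2 ^ n) f x‖ₑ) n

theorem pathMax_le_dyadicMaximal {f : ℝ → ℝ} (hf : Integrable f unitMeasure) {x : ℝ}
    (hx : x ∈ Set.Ico (0 : ℝ) 1) {p : ℝ} (hp : 0 < p) (n : ℕ) :
    ENNReal.ofReal (pathMax (fun n c => |cellAvg f n c| ^ p) n (cell n x)) ≤
      dyadicMaximal f x ^ p := by
  have h : ∀ n, ENNReal.ofReal (|cellAvg f n (cell n x)| ^ p) ≤ dyadicMaximal f x ^ p := by
    intro n
    rw [← ENNReal.ofReal_rpow_of_nonneg (abs_nonneg _) hp.le]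
    exact ENNReal.rpow_le_rpow (abs_avgSeq_le_dyadicMaximal hf hx n) hp.le
  induction n with
  | zero => exact h 0
  | succ n ih =>
    rw [pathMax, cell_succ_div_two, ENNReal.ofReal_max]
    exact max_le ih (h _)

theorem lintegral_ofReal_comp_cell (n : ℕ) {G : ℕ → ℝ} (hG : ∀ c, 0 ≤ G c) :
    ∫⁻ x, ENNReal.ofReal (G (cell n x)) ∂unitMeasure =
      ENNReal.ofReal ((2 ^ n)⁻¹ * ∑ c ∈ Finset.range (2 ^ n), G c) := by
  rw [lintegral_comp_cell n fun c => ENNReal.ofReal (G c), Finset.mul_sum,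
    ENNReal.ofReal_sum_of_nonneg fun c _ => mul_nonneg (by positivity) (hG c)]
  exact Finset.sum_congr rfl fun c _ => by rw [mul_comm, ENNReal.ofReal_mul (by positivity)]

theorem pathMax_nonneg {v : ℕ → ℕ → ℝ} (hv : ∀ n c, 0 ≤ v n c) (n c : ℕ) :
    0 ≤ pathMax v n c := by
  cases n with
  | zero => exact hv 0 c
  | succ n => exact le_max_of_le_right (hv _ _)

/-- The tree comparison is applied to `|f_n|^p` itself. The factor 2 is the ratio of cell lengths at
levels `m` and `m + 1`. -/
theorem lintegral_majorant_le {f : ℝ → ℝ} (hf : Integrable f unitMeasure) {p : ℝ} (hp : 0 < p)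
    (m : ℕ) : ∫⁻ x, ENNReal.ofReal (majorant f m (cell m x) ^ p) ∂unitMeasure ≤
      2 * ∫⁻ x, dyadicMaximal f x ^ p ∂unitMeasure := by
  have hv : ∀ n c, 0 ≤ |cellAvg f n c| ^ p := fun n c => Real.rpow_nonneg (abs_nonneg _) p
  have hmean : ∀ n c, |cellAvg f n c| ^ p ≤
      max (|cellAvg f (n + 1) (2 * c)| ^ p) (|cellAvg f (n + 1) (2 * c + 1)| ^ p) := by
    intro n c
    rw [← max_rpow (abs_nonneg _) (abs_nonneg _) hp.le]
    exact Real.rpow_le_rpow (abs_nonneg _) (abs_cellAvg_le hf n c) hp.le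
  have h1 := sum_childMax_le (v := fun n c => |cellAvg f n c| ^ p) hmean hv m
  have h2 : ∫⁻ x, ENNReal.ofReal
      (pathMax (fun n c => |cellAvg f n c| ^ p) (m + 1) (cell (m + 1) x)) ∂unitMeasure ≤
      ∫⁻ x, dyadicMaximal f x ^ p ∂unitMeasure :=
    lintegral_mono_ae (ae_mem_unit.mono fun x hx => pathMax_le_dyadicMaximal hf hx hp (m + 1))
  rw [lintegral_ofReal_comp_cell _ fun c => pathMax_nonneg hv _ c] at h2
  rw [lintegral_ofReal_comp_cell m fun c => Real.rpow_nonneg (majorant_nonneg f m c) p]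
  refine le_trans ?_ (mul_le_mul_right h2 2)
  rw [show (2 : ℝ≥0∞) = ENNReal.ofReal 2 by simp, ← ENNReal.ofReal_mul two_pos.le]
  refine ENNReal.ofReal_le_ofReal ?_
  simp only [majorant, childMax_rpow (v := fun n c => |cellAvg f n c|) (fun _ _ => abs_nonneg _)
    hp.le]
  rw [pow_succ, mul_inv, ← mul_assoc, mul_comm 2, mul_assoc _ _ (2 : ℝ), inv_mul_cancel₀ two_ne_zero,
    mul_one]
  exact mul_le_mul_of_nonneg_left h1 (by positivity)

/-- The three factors come from the height being twice the size, the geometric series of new values,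
and the rounding to powers of two. -/
theorem sum_atomSize_rpow_le (f : ℝ → ℝ) {p : ℝ} (hp : 0 < p) (m : ℕ) (x : ℝ) :
    ∑ n ∈ Finset.range (m + 1), (2 * atomSize f n x) ^ p ≤
      2 ^ p * (2 ^ p / (2 ^ p - 1)) * 2 ^ p * majorant f m (cell m x) ^ p := by
  classical
  have h1 : (1 : ℝ) < 2 ^ p := Real.one_lt_rpow one_lt_two hp
  have h0 : (0 : ℝ) < 2 ^ p - 1 := by linarith
  have hg0 : ∀ i, 0 ≤ majSeq f x i := fun i => roundUp_nonneg _
  have e : ∀ n ∈ Finset.range (m + 1), (2 * atomSize f n x) ^ p =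
      2 ^ p * if IsNew (majSeq f x) n then majSeq f x n ^ p else 0 := by
    intro n _
    rw [atomSize]
    split_ifs
    · rw [Real.mul_rpow two_pos.le (hg0 n)]
    · rw [mul_zero, mul_zero, Real.zero_rpow hp.ne']
  rw [Finset.sum_congr rfl e, ← Finset.mul_sum, mul_assoc, mul_assoc]
  refine mul_le_mul_of_nonneg_left ((sum_isNew_rpow_le (monotone_majSeq f x) hg0
    (fun i j => two_mul_roundUp_le) hp m).trans ?_) (by positivity)
  rw [← Real.mul_rpow two_pos.le (majorant_nonneg f m _)]
  exact mul_le_mul_of_nonneg_left (Real.rpow_le_rpow (hg0 m)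
    (roundUp_le (majorant_nonneg f m _)) hp.le) (by positivity)

theorem atomSize_nonneg (f : ℝ → ℝ) (n : ℕ) (x : ℝ) : 0 ≤ atomSize f n x := by
  classical
  rw [atomSize]
  split_ifs
  exacts [roundUp_nonneg _, le_rfl]

theorem sum_atomSize_le {f : ℝ → ℝ} (hf : Integrable f unitMeasure) {p : ℝ} (hp : 0 < p) (m : ℕ) :
    ∑ n ∈ Finset.range (m + 1), ∑ J ∈ Finset.range (2 ^ n),
      ENNReal.ofReal ((2 * atomSize f n (cellPoint n J)) ^ p) * ENNReal.ofReal (2 ^ n)⁻¹ ≤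
    ENNReal.ofReal (2 ^ p * (2 ^ p / (2 ^ p - 1)) * 2 ^ p) *
      (2 * ∫⁻ x, dyadicMaximal f x ^ p ∂unitMeasure) := by
  have h1 : (1 : ℝ) < 2 ^ p := Real.one_lt_rpow one_lt_two hp
  have h0 : (0 : ℝ) < 2 ^ p - 1 := by linarith
  have e : ∀ n ∈ Finset.range (m + 1), ∑ J ∈ Finset.range (2 ^ n),
      ENNReal.ofReal ((2 * atomSize f n (cellPoint n J)) ^ p) * ENNReal.ofReal (2 ^ n)⁻¹ =
      ∫⁻ x, ENNReal.ofReal ((2 * atomSize f n x) ^ p) ∂unitMeasure := by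
    intro n _
    rw [← lintegral_comp_cell n fun J => ENNReal.ofReal ((2 * atomSize f n (cellPoint n J)) ^ p)]
    refine lintegral_congr fun x => ?_
    rw [cellFun_atomSize f n _ x (cell_cellPoint n _)]
  rw [Finset.sum_congr rfl e, ← lintegral_finsetSum _ fun n _ =>
    (((cellFun_atomSize f n).measurable.const_mul 2).pow_const p).ennreal_ofReal]
  refine le_trans ?_ (mul_le_mul_right (lintegral_majorant_le hf hp m) _)
  rw [← lintegral_const_mul' _ _ ENNReal.ofReal_ne_top]
  refine lintegral_mono fun x => ?_
  rw [← ENNReal.ofReal_sum_of_nonneg fun n _ =>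
    Real.rpow_nonneg (mul_nonneg two_pos.le (atomSize_nonneg f n x)) p,
    ← ENNReal.ofReal_mul (by positivity)]
  exact ENNReal.ofReal_le_ofReal (sum_atomSize_rpow_le f hp m x)

/-! ### Sufficiency -/

theorem eLpNorm_ofReal_eq {p : ℝ} (hp : 0 < p) (g : ℝ → ℝ≥0∞) :
    eLpNorm g (ENNReal.ofReal p) unitMeasure = (∫⁻ x, g x ^ p ∂unitMeasure) ^ (1 / p) := by
  rw [eLpNorm_eq_lintegral_rpow_enorm_toReal (by simpa using hp) ENNReal.ofReal_ne_top,
    ENNReal.toReal_ofReal hp.le]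
  simp only [enorm_eq_self]

theorem maximalBoundedHardy_of_bddAbove {q : ℕ → ℝ} (hpos : ∀ k, 0 < q k) (hanti : Antitone q)
    (hinf : MaximalBoundedLInfty q) {p : ℝ} (hp : 0 < p) (hp1 : p ≤ 1)
    (hbdd : BddAbove (Set.range (hardyQuantity q p))) : MaximalBoundedHardy q p := by
  obtain ⟨C, hC⟩ := exists_lintegral_atom_le hpos hanti hinf hp hbdd
  obtain ⟨C₀, hC₀⟩ := hinf
  set D : ℝ≥0 := (2 ^ p * (2 ^ p / (2 ^ p - 1)) * 2 ^ p : ℝ).toNNReal with hD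
  -- `C₀ ^ p` pays for the constant `cellAvg f 0 0`, the other term for the atoms.
  set E : ℝ≥0 := C₀ ^ p + C * (D * 2) with hE
  have hmain : ∀ f, Integrable f unitMeasure →
      ∫⁻ x, norlundMaximal q f x ^ p ∂unitMeasure ≤
        E * ∫⁻ x, dyadicMaximal f x ^ p ∂unitMeasure := by
    intro f hf
    rw [lintegral_norlundMaximal_rpow q f hp]
    refine iSup_le fun m => ?_
    have hconst : ∫⁻ x, norlundMaximal q (fun _ => cellAvg f 0 0) x ^ p ∂unitMeasure ≤
        (C₀ : ℝ≥0∞) ^ p * ∫⁻ x, dyadicMaximal f x ^ p ∂unitMeasure := by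
      rw [← lintegral_const_mul' _ _ (ENNReal.rpow_ne_top_of_nonneg hp.le ENNReal.coe_ne_top)]
      refine lintegral_mono_ae ?_
      filter_upwards [norlundMaximal_ae_le hC₀ (measurable_const (a := cellAvg f 0 0))
        (fun _ => le_rfl), ae_mem_unit] with x hx hx1
      rw [← ENNReal.mul_rpow_of_nonneg _ _ hp.le]
      refine ENNReal.rpow_le_rpow (hx.trans (mul_le_mul_right ?_ _)) hp.le
      have := abs_avgSeq_le_dyadicMaximal hf hx1 0
      rwa [cell_zero hx1] at this
    calc ∫⁻ x, truncatedMaximal q (m + 1) f x ^ p ∂unitMeasure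
        ≤ ∫⁻ x, norlundMaximal q (fun _ => cellAvg f 0 0) x ^ p +
          ∑ k ∈ (Finset.range (m + 1)).sigma fun n => Finset.range (2 ^ n),
            norlundMaximal q (atomFun f (m + 1) k.1 k.2) x ^ p ∂unitMeasure := by
          refine lintegral_mono fun x => ?_
          refine (ENNReal.rpow_le_rpow (truncatedMaximal_le hf q (m + 1) x) hp.le).trans ?_
          exact (ENNReal.rpow_add_le_add_rpow _ _ hp.le hp1).trans
            (add_le_add le_rfl (sum_rpow_le _ _ hp hp1))
      _ = ∫⁻ x, norlundMaximal q (fun _ => cellAvg f 0 0) x ^ p ∂unitMeasure +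
          ∑ k ∈ (Finset.range (m + 1)).sigma fun n => Finset.range (2 ^ n),
            ∫⁻ x, norlundMaximal q (atomFun f (m + 1) k.1 k.2) x ^ p ∂unitMeasure := by
          rw [lintegral_add_left ((measurable_norlundMaximal _ _).pow_const p),
            lintegral_finsetSum _ fun k _ => (measurable_norlundMaximal _ _).pow_const p]
      _ ≤ (C₀ : ℝ≥0∞) ^ p * ∫⁻ x, dyadicMaximal f x ^ p ∂unitMeasure +
          ∑ k ∈ (Finset.range (m + 1)).sigma fun n => Finset.range (2 ^ n),
            C * (ENNReal.ofReal ((2 * atomSize f k.1 (cellPoint k.1 k.2)) ^ p) *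
              ENNReal.ofReal (2 ^ k.1)⁻¹) := by
          refine add_le_add hconst (Finset.sum_le_sum fun k hk => ?_)
          obtain ⟨h1, h2⟩ := Finset.mem_sigma.1 hk
          rw [← mul_assoc]
          exact hC _ _ _ _ (Finset.mem_range.1 h2)
            (isAtom_atomFun hf (Finset.mem_range.1 h1).le)
      _ ≤ (C₀ : ℝ≥0∞) ^ p * ∫⁻ x, dyadicMaximal f x ^ p ∂unitMeasure +
          C * (D * (2 * ∫⁻ x, dyadicMaximal f x ^ p ∂unitMeasure)) := by
          rw [← Finset.mul_sum, Finset.sum_sigma]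
          gcongr
          exact sum_atomSize_le hf hp m
      _ = E * ∫⁻ x, dyadicMaximal f x ^ p ∂unitMeasure := by
          rw [hE]
          push_cast
          rw [ENNReal.coe_rpow_of_nonneg _ hp.le]
          ring
  refine ⟨E ^ (1 / p), fun f hf => ?_⟩
  rw [hardyNorm, eLpNorm_ofReal_eq hp, eLpNorm_ofReal_eq hp,
    ENNReal.coe_rpow_of_nonneg _ (by positivity), ← ENNReal.mul_rpow_of_nonneg _ _ (by positivity)]
  exact ENNReal.rpow_le_rpow (hmain f hf.1) (by positivity)

/-! ### Necessity -/

/-- The difference of the Dirichlet kernels of orders `2 ^ (N + 1)` and `2 ^ N`. -/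
def testFun (N : ℕ) (x : ℝ) : ℝ := rad x N * if cell N x = 0 then 2 ^ N else 0

theorem testFun_eq (N : ℕ) (x : ℝ) : testFun N x =
    (fun c : ℕ => (-1 : ℝ) ^ (c % 2) * if c / 2 = 0 then 2 ^ N else 0) (cell (N + 1) x) := by
  simp only [testFun, rad, digit_eq_cell, cell_succ_div_two]

theorem integrable_testFun (N : ℕ) : Integrable (testFun N) unitMeasure := by
  rw [funext (testFun_eq N)]
  exact integrable_comp_cell (N + 1)
    fun c : ℕ => (-1 : ℝ) ^ (c % 2) * if c / 2 = 0 then 2 ^ N else 0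

theorem integral_testFun (N : ℕ) : ∫ x, testFun N x ∂unitMeasure = 0 := by
  simp only [testFun_eq]
  rw [integral_comp_cell (N + 1) fun c : ℕ => (-1 : ℝ) ^ (c % 2) * if c / 2 = 0 then 2 ^ N else 0,
    sum_range_two_pow_succ, Finset.sum_eq_zero, mul_zero]
  intro c _
  rw [show 2 * c / 2 = c by omega, show (2 * c + 1) / 2 = c by omega,
    show 2 * c % 2 = 0 by omega, show (2 * c + 1) % 2 = 1 by omega]
  ring

theorem walsh_eq_one {N l : ℕ} (hl : l < 2 ^ N) {x : ℝ} (hx : cell N x = 0) : walsh l x = 1 := by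
  have h0 : cell N x = cell N 0 := by rw [hx]; simp [cell]
  rw [walsh_congr hl h0]
  simp [walsh, digit]

theorem walshCoeff_testFun_of_lt {N i : ℕ} (hi : i < 2 ^ N) : walshCoeff (testFun N) i = 0 := by
  rw [walshCoeff, ← integral_testFun N]
  refine integral_congr_ae (.of_forall fun t => ?_)
  by_cases h : cell N t = 0
  · simp only [walsh_eq_one hi h, mul_one]
  · simp [testFun, h]

theorem walsh_two_pow_add {N l : ℕ} (hl : l < 2 ^ N) (x : ℝ) :
    walsh (2 ^ N + l) x = rad x N * walsh l x := by
  have := signWalsh_two_pow_mul_add (k := 1) hl (rad x)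
  rw [mul_one, signWalsh_two_pow] at this
  rw [walsh_eq, walsh_eq, this]

theorem walshCoeff_testFun_add {N l : ℕ} (hl : l < 2 ^ N) :
    walshCoeff (testFun N) (2 ^ N + l) = 1 := by
  have : walshCoeff (testFun N) (2 ^ N + l) =
      ∫ x, (fun c : ℕ => if c = 0 then (2 : ℝ) ^ N else 0) (cell N x) ∂unitMeasure := by
    refine integral_congr_ae (.of_forall fun t => ?_)
    simp only [testFun]
    split_ifs with h
    · rw [walsh_two_pow_add hl, walsh_eq_one hl h, mul_one]
      have := rad_mul_rad_eq_one (rfl : digit t N = digit t N)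
      linear_combination (2 : ℝ) ^ N * this
    · simp
  rw [this, integral_comp_cell N fun c : ℕ => if c = 0 then (2 : ℝ) ^ N else 0,
    Finset.sum_ite_eq' (Finset.range (2 ^ N)) 0, if_pos (by simp)]
  exact inv_mul_cancel₀ (by positivity)

theorem partialSum_testFun_of_le {N M : ℕ} (hM : M ≤ 2 ^ N) (x : ℝ) :
    partialSum M (testFun N) x = 0 :=
  Finset.sum_eq_zero fun i hi => by
    rw [walshCoeff_testFun_of_lt ((Finset.mem_range.1 hi).trans_le hM), zero_mul]

theorem partialSum_testFun_add {N l : ℕ} (hl : l ≤ 2 ^ N) (x : ℝ) :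
    partialSum (2 ^ N + l) (testFun N) x = rad x N * signDirichlet l (rad x) := by
  have h0 := partialSum_testFun_of_le (le_refl (2 ^ N)) x
  rw [partialSum] at h0
  rw [partialSum, Finset.sum_range_add, h0, zero_add, signDirichlet, Finset.mul_sum]
  refine Finset.sum_congr rfl fun i hi => ?_
  have hi := (Finset.mem_range.1 hi).trans_le hl
  rw [walshCoeff_testFun_add hi, one_mul, walsh_two_pow_add hi, walsh_eq]

theorem norlundMean_testFun {N r : ℕ} (hr : r ≤ 2 ^ N) (q : ℕ → ℝ) (x : ℝ) :
    norlundMean q (2 ^ N + r) (testFun N) x = rad x N *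
      (∑ l ∈ Finset.range (r + 1), q (r - l) * signDirichlet l (rad x)) /
        weightSum q (2 ^ N + r) := by
  rw [norlundMean_eq, add_assoc, Finset.sum_range_add, Finset.sum_eq_zero, zero_add,
    Finset.mul_sum]
  · congr 1
    refine Finset.sum_congr rfl fun l hl => ?_
    have := Finset.mem_range.1 hl
    rw [partialSum_testFun_add (by omega), Nat.add_sub_add_left]
    ring
  · intro k hk
    rw [partialSum_testFun_of_le (Finset.mem_range.1 hk).le, mul_zero]

/-- The weights `q i` with `i < M` multiply indices of size at least `M`; monotonicity gives `Q_{2M}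
≤ 2 Q_M`. -/
theorem weightSum_le_sum_mul {q : ℕ → ℝ} (hpos : ∀ k, 0 < q k) (hanti : Antitone q) (M : ℕ) :
    (2 * M : ℕ) * weightSum q (2 * M) ≤
      4 * ∑ l ∈ Finset.range (2 * M + 1), q (2 * M - l) * (l : ℝ) := by
  have h1 : weightSum q (2 * M) ≤ 2 * weightSum q M := by
    have := weightSum_mul_le hanti M 2
    rw [mul_comm M 2] at this
    exact_mod_cast this
  have h2 : M * weightSum q M ≤ ∑ l ∈ Finset.range (2 * M + 1), q (2 * M - l) * (l : ℝ) := by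
    rw [← Finset.sum_range_reflect]
    calc M * weightSum q M = ∑ i ∈ Finset.range M, q i * (M : ℝ) := by
          rw [weightSum, ← Finset.sum_mul, mul_comm]
      _ ≤ ∑ i ∈ Finset.range M, q (2 * M - (2 * M + 1 - 1 - i)) *
            ((2 * M + 1 - 1 - i : ℕ) : ℝ) := by
          refine Finset.sum_le_sum fun i hi => ?_
          have := Finset.mem_range.1 hi
          rw [show 2 * M - (2 * M + 1 - 1 - i) = i by omega]
          refine mul_le_mul_of_nonneg_left ?_ (hpos i).le
          exact_mod_cast (show M ≤ 2 * M + 1 - 1 - i by omega)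
      _ ≤ _ := Finset.sum_le_sum_of_subset_of_nonneg
          (Finset.range_subset_range.2 (by omega)) fun i _ _ =>
            mul_nonneg (hpos _).le (Nat.cast_nonneg _)
  push_cast
  nlinarith [mul_le_mul_of_nonneg_left h1 (Nat.cast_nonneg (α := ℝ) M)]

/-- In the mean of order `2^N + 2^s` all kernels satisfy `D_l = l` on this cell, so nothing cancels.
The 8 is 4 from the numerator times 2 from `Q_{2^N + 2^s} ≤ 2 Q_{2^N}`. -/
theorem le_norlundMaximal_testFun {q : ℕ → ℝ} (hpos : ∀ k, 0 < q k) (hanti : Antitone q)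
    {N s : ℕ} (hs : 1 ≤ s) (hsN : s ≤ N) {x : ℝ} (hx : cell s x = 0) :
    ENNReal.ofReal (2 ^ s * weightSum q (2 ^ s) / (8 * weightSum q (2 ^ N))) ≤
      norlundMaximal q (testFun N) x := by
  have hle : 2 ^ s ≤ 2 ^ N := Nat.pow_le_pow_right two_pos hsN
  refine le_iSup₂_of_le (2 ^ N + 2 ^ s) (by have := Nat.two_pow_pos s; omega) ?_
  rw [Real.enorm_eq_ofReal_abs, norlundMean_testFun hle]
  refine ENNReal.ofReal_le_ofReal ?_
  have hD : ∀ l ∈ Finset.range (2 ^ s + 1), q (2 ^ s - l) * signDirichlet l (rad x) =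
      q (2 ^ s - l) * (l : ℝ) := by
    intro l hl
    rw [signDirichlet_of_ones (N := s) (fun j hj => ?_)
      (Nat.lt_succ_iff.1 (Finset.mem_range.1 hl))]
    have := digit_eq_of_cell_eq (x := x) (y := 0) (by rw [hx]; simp [cell]) hj
    rw [rad, this]
    simp [digit]
  have hQn := weightSum_pos hpos (n := 2 ^ N + 2 ^ s) (by have := Nat.two_pow_pos s; omega)
  have hQN : weightSum q (2 ^ N + 2 ^ s) ≤ 2 * weightSum q (2 ^ N) :=
    (weightSum_mono hpos (by omega : 2 ^ N + 2 ^ s ≤ 2 ^ N * 2)).trans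
      (by exact_mod_cast weightSum_mul_le hanti (2 ^ N) 2)
  rw [Finset.sum_congr rfl hD, abs_div, abs_mul, abs_rad, one_mul, abs_of_pos hQn]
  obtain ⟨t, rfl⟩ : ∃ t, s = t + 1 := ⟨s - 1, by omega⟩
  have h4 := weightSum_le_sum_mul hpos hanti (2 ^ t)
  rw [← pow_succ'] at h4
  push_cast at h4
  set S := ∑ l ∈ Finset.range (2 ^ (t + 1) + 1), q (2 ^ (t + 1) - l) * (l : ℝ)
  have hS0 : 0 ≤ S := Finset.sum_nonneg fun i _ => mul_nonneg (hpos _).le (Nat.cast_nonneg _)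
  rw [abs_of_nonneg hS0, div_le_div_iff₀ (by linarith) hQn]
  calc _ ≤ 4 * S * (2 * weightSum q (2 ^ N)) := by gcongr
    _ = _ := by ring

theorem dyadicMaximal_testFun_le (N : ℕ) {x : ℝ} (hx : x ∈ Set.Ico (0 : ℝ) 1) :
    dyadicMaximal (testFun N) x ≤ ENNReal.ofReal (if cell N x = 0 then 2 ^ N else 0) := by
  refine iSup_le fun n => ?_
  rw [Real.enorm_eq_ofReal_abs]
  refine ENNReal.ofReal_le_ofReal ?_
  rcases le_total n N with h | h
  · rw [partialSum_testFun_of_le (Nat.pow_le_pow_right two_pos h), abs_zero]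
    split_ifs <;> positivity
  · rw [partialSum_two_pow (integrable_testFun N) n hx, cellAvg, abs_mul,
      abs_of_pos (by positivity)]
    have := norm_setIntegral_le_of_norm_le_const (μ := unitMeasure) (s := cellSet n (cell n x))
      (f := testFun N) (C := if cell N x = 0 then 2 ^ N else 0) (measure_lt_top _ _) fun t ht => by
        rw [testFun, cell_eq_of_le h (mem_cellSet.1 ht), Real.norm_eq_abs, abs_mul, abs_rad, one_mul]
        split_ifs <;> simp
    rw [unitMeasure_real_cellSet (cell_lt hx n), Real.norm_eq_abs] at this
    refine (mul_le_mul_of_nonneg_left this (by positivity)).trans_eq ?_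
    field_simp

theorem lintegral_dyadicMaximal_testFun_le (N : ℕ) {p : ℝ} (hp : 0 < p) :
    ∫⁻ x, dyadicMaximal (testFun N) x ^ p ∂unitMeasure ≤
      ENNReal.ofReal (((2 : ℝ) ^ N) ^ p * (2 ^ N)⁻¹) := by
  calc ∫⁻ x, dyadicMaximal (testFun N) x ^ p ∂unitMeasure
      ≤ ∫⁻ x, (cellSet N 0).indicator (fun _ => ENNReal.ofReal (((2 : ℝ) ^ N) ^ p)) x
        ∂unitMeasure := by
        refine lintegral_mono_ae (ae_mem_unit.mono fun x hx => ?_)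
        refine (ENNReal.rpow_le_rpow (dyadicMaximal_testFun_le N hx) hp.le).trans ?_
        rw [indicator_cellSet]
        split_ifs
        · rw [ENNReal.ofReal_rpow_of_nonneg (by positivity) hp.le]
        · simp [hp]
    _ = _ := by
        rw [lintegral_indicator_const (measurableSet_cellSet N 0),
          unitMeasure_cellSet (Nat.two_pow_pos N), ENNReal.ofReal_mul (by positivity)]

theorem cell_mono (x : ℝ) : Monotone fun n => cell n x :=
  monotone_nat_of_le_succ fun n => by
    have := cell_succ n x
    omega

/-- Disjointness of the intervals `[2^{-s-1}, 2^{-s})`. -/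
theorem eq_of_cell_succ_eq_one {s t : ℕ} {x : ℝ} (hs : cell (s + 1) x = 1)
    (ht : cell (t + 1) x = 1) : s = t := by
  have key : ∀ {a b : ℕ}, cell (a + 1) x = 1 → cell (b + 1) x = 1 → ¬ a < b := by
    intro a b ha hb hab
    have h1 : cell (a + 1) x ≤ cell b x := cell_mono x hab
    have h2 := cell_succ_div_two b x
    omega
  exact le_antisymm (not_lt.1 (key ht hs)) (not_lt.1 (key hs ht))

theorem sum_le_lintegral_testFun {q : ℕ → ℝ} (hpos : ∀ k, 0 < q k) (hanti : Antitone q) (N : ℕ)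
    {p : ℝ} (hp : 0 < p) :
    ENNReal.ofReal (∑ s ∈ Finset.Icc 1 N,
      (2 ^ s * weightSum q (2 ^ s) / (8 * weightSum q (2 ^ N))) ^ p * (2 ^ (s + 1))⁻¹) ≤
      ∫⁻ x, norlundMaximal q (testFun N) x ^ p ∂unitMeasure := by
  set X : ℕ → ℝ := fun s => 2 ^ s * weightSum q (2 ^ s) / (8 * weightSum q (2 ^ N)) with hX
  have hX0 : ∀ s, 0 ≤ X s := fun s => by
    have := weightSum_nonneg hpos (2 ^ s)
    have := weightSum_nonneg hpos (2 ^ N)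
    simp only [hX]
    positivity
  have hXp : ∀ s, 0 ≤ X s ^ p := fun s => Real.rpow_nonneg (hX0 s) p
  have hmeas : ∀ s, Measurable
      ((cellSet (s + 1) 1).indicator fun _ => ENNReal.ofReal (X s ^ p)) :=
    fun s => measurable_const.indicator (measurableSet_cellSet _ _)
  calc ENNReal.ofReal (∑ s ∈ Finset.Icc 1 N, X s ^ p * (2 ^ (s + 1))⁻¹)
      = ∫⁻ x, ∑ s ∈ Finset.Icc 1 N,
          (cellSet (s + 1) 1).indicator (fun _ => ENNReal.ofReal (X s ^ p)) x ∂unitMeasure := by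
        rw [lintegral_finsetSum _ fun s _ => hmeas s,
          ENNReal.ofReal_sum_of_nonneg fun s _ => mul_nonneg (hXp s) (by positivity)]
        refine Finset.sum_congr rfl fun s _ => ?_
        rw [lintegral_indicator_const (measurableSet_cellSet _ _),
          unitMeasure_cellSet (Nat.one_lt_two_pow (Nat.succ_ne_zero s)),
          ENNReal.ofReal_mul (hXp s)]
    _ ≤ _ := by
        refine lintegral_mono fun x => ?_
        by_cases h : ∃ s ∈ Finset.Icc 1 N, cell (s + 1) x = 1
        · obtain ⟨s, hs, hsx⟩ := h
          rw [Finset.sum_eq_single_of_mem s hs fun t _ hts => by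
            rw [indicator_cellSet, if_neg fun ht => hts (eq_of_cell_succ_eq_one ht hsx)]]
          rw [indicator_cellSet, if_pos hsx, ← ENNReal.ofReal_rpow_of_nonneg (hX0 s) hp.le]
          have hs := Finset.mem_Icc.1 hs
          refine ENNReal.rpow_le_rpow (le_norlundMaximal_testFun hpos hanti hs.1 hs.2 ?_) hp.le
          rw [← cell_succ_div_two, hsx]
        · push Not at h
          rw [Finset.sum_eq_zero fun s hs => by rw [indicator_cellSet, if_neg (h s hs)]]
          exact zero_le

theorem bddAbove_of_maximalBoundedHardy {q : ℕ → ℝ} (hpos : ∀ k, 0 < q k) (hanti : Antitone q)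
    {p : ℝ} (hp : 0 < p) (h : MaximalBoundedHardy q p) :
    BddAbove (Set.range (hardyQuantity q p)) := by
  obtain ⟨C, hC⟩ := h
  -- The 2 comes from the measure `2^{-(s+1)}`, the `8 ^ p` from the pointwise lower bound.
  refine ⟨2 * 8 ^ p * (C : ℝ) ^ p, ?_⟩
  rintro _ ⟨N, rfl⟩
  have hfin := lintegral_dyadicMaximal_testFun_le N hp
  have hmem : MemHardy p (testFun N) := by
    refine ⟨integrable_testFun N, ?_⟩
    rw [hardyNorm, eLpNorm_ofReal_eq hp]
    exact ENNReal.rpow_lt_top_of_nonneg (by positivity)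
      (hfin.trans_lt ENNReal.ofReal_lt_top).ne
  have h1 := hC _ hmem
  rw [hardyNorm, eLpNorm_ofReal_eq hp, eLpNorm_ofReal_eq hp] at h1
  have h2 := ENNReal.rpow_le_rpow h1 hp.le
  rw [ENNReal.mul_rpow_of_nonneg _ _ hp.le, ← ENNReal.rpow_mul, ← ENNReal.rpow_mul,
    one_div_mul_cancel hp.ne', ENNReal.rpow_one, ENNReal.rpow_one] at h2
  have h3 := (sum_le_lintegral_testFun hpos hanti N hp).trans
    (h2.trans (mul_le_mul_right hfin _))
  have hCp : (C : ℝ≥0∞) ^ p = ENNReal.ofReal ((C : ℝ) ^ p) := by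
    rw [← ENNReal.ofReal_rpow_of_nonneg C.coe_nonneg hp.le, ENNReal.ofReal_coe_nnreal]
  rw [hCp, ← ENNReal.ofReal_mul (by positivity), ENNReal.ofReal_le_ofReal_iff (by positivity)] at h3
  have hQ : ∀ n, 0 < weightSum q (2 ^ n) := fun n => weightSum_pos hpos Nat.one_le_two_pow
  have hQN := hQ N
  have e1 : ∀ s ∈ Finset.Icc 1 N,
      (2 ^ s * weightSum q (2 ^ s) / (8 * weightSum q (2 ^ N))) ^ p * (2 ^ (s + 1))⁻¹ =
      (2 * 8 ^ p * weightSum q (2 ^ N) ^ p)⁻¹ *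
        (weightSum q (2 ^ s) ^ p * (2 : ℝ) ^ ((s : ℝ) * (p - 1))) := by
    intro s _
    have := hQ s
    rw [Real.div_rpow (by positivity) (by positivity), Real.mul_rpow (by positivity) this.le,
      Real.mul_rpow (by positivity) hQN.le, mul_sub, mul_one, Real.rpow_sub two_pos,
      Real.rpow_mul two_pos.le, Real.rpow_natCast, pow_succ]
    field_simp
  have e2 : (2 : ℝ) ^ ((N : ℝ) * (1 - p)) = 2 ^ N / ((2 : ℝ) ^ N) ^ p := by
    rw [mul_sub, mul_one, Real.rpow_sub two_pos, Real.rpow_mul two_pos.le, Real.rpow_natCast]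
  rw [Finset.sum_congr rfl e1, ← Finset.mul_sum] at h3
  rw [hardyQuantity, e2]
  generalize ∑ j ∈ Finset.Icc 1 N, weightSum q (2 ^ j) ^ p * (2 : ℝ) ^ ((j : ℝ) * (p - 1)) = S
    at h3 ⊢
  have hc : 0 ≤ 2 * 8 ^ p * (2 ^ N / ((2 : ℝ) ^ N) ^ p) := by positivity
  calc 2 ^ N / ((2 : ℝ) ^ N) ^ p / weightSum q (2 ^ N) ^ p * S
      = 2 * 8 ^ p * (2 ^ N / ((2 : ℝ) ^ N) ^ p) *
          ((2 * 8 ^ p * weightSum q (2 ^ N) ^ p)⁻¹ * S) := by field_simp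
    _ ≤ _ := mul_le_mul_of_nonneg_left h3 hc
    _ = 2 * 8 ^ p * (C : ℝ) ^ p := by field_simp

end WalshNorlund

end

/-! ### The characterization of boundedness on `H_p` -/

theorem mainTheorem1 (q : ℕ → ℝ) (hpos : ∀ k, 0 < q k) (hanti : Antitone q)
    (hinf : WalshNorlund.MaximalBoundedLInfty q) (p : ℝ) (hp : 1 / 2 < p) (hp1 : p ≤ 1) :
    WalshNorlund.MaximalBoundedHardy q p ↔
      BddAbove (Set.range fun N : ℕ =>
        (2 : ℝ) ^ ((N : ℝ) * (1 - p)) / WalshNorlund.weightSum q (2 ^ N) ^ p *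
          ∑ j ∈ Finset.Icc 1 N,
            WalshNorlund.weightSum q (2 ^ j) ^ p * (2 : ℝ) ^ ((j : ℝ) * (p - 1))) := by
  have hp0 : 0 < p := by linarith
  exact ⟨WalshNorlund.bddAbove_of_maximalBoundedHardy hpos hanti hp0,
    WalshNorlund.maximalBoundedHardy_of_bddAbove hpos hanti hinf hp0 hp1⟩
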